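/- Let $n\ge 1$ be an integer. Let $\Pi_n$ be the lattice of set partitions of $\{1,\dots,n\}$ ordered by refinement, and let $\bar\Pi_n=\Pi_n\setminus\{\hat 0,\hat 1\}$ be its proper part, with the action of $\mathfrak S_n$ induced by its action on $\{1,\dots,n\}$. Let $\tilde H_j(\bar\Pi_n)$ denote the reduced simplicial homology with complex coefficients of the order complex of $\bar\Pi_n$ (the simplicial complex of chains of $\bar\Pi_n$), where the empty poset $\bar\Pi_2$ has order complex $\{\emptyset\}$, so that $\tilde H_{-1}(\bar\Pi_2)=\mathbb C$, and where for $n=1$, when $\hat 0=\hat 1$, one uses the convention that $\tilde H_{-2}(\bar\Pi_1)=\mathbb C$ is the trivial module and the other homology is zero. Let $\mathfrak C_n$ be the cyclic subgroup of $\mathfrak S_n$ generated by $\sigma:=(1,2,\dots,n)$, let $e^{2\pi i/n}$ denote the one-dimensional complex representation of $\mathfrak C_n$ whose character value at $\sigma$ is $e^{2\pi i/n}$, and let $\mathrm{sgn}_n$ be the sign representation of $\mathfrak S_n$. Then $$\tilde H_{n-3}(\bar\Pi_n)\;\cong_{\mathfrak S_n}\; e^{2\pi i/n}\uparrow_{\mathfrak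 C_n}^{\mathfrak S_n}\otimes\,\mathrm{sgn}_n ,$$ where $\uparrow$ denotes induction; that is, the two sides are isomorphic as complex representations of $\mathfrak S_n$. -/

import Mathlib

/-! ## Reduced simplicial homology of the order complex of a poset, with group action -/

/-- The space of simplicial chains of the order complex of the poset `Q` that are spanned by the
faces with `k` elements (the faces of dimension `k - 1`): it has as basis the chains
`x₀ < x₁ < ⋯ < x_{k-1}` of `Q`.  For `k = 0` the only basis element is the empty chain. -/
abbrev OrderChains (Q : Type) [PartialOrder Q] (k : ℕ) : Type :=
  (Fin k ↪o Q) →₀ ℂ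

/-- The simplicial boundary map
`(x₀ < ⋯ < x_k) ↦ ∑ i, (-1) ^ i (x₀ < ⋯ < x_{i-1} < x_{i+1} < ⋯ < x_k)`.
For `k = 0` it is the augmentation. -/
noncomputable def orderBoundary (Q : Type) [PartialOrder Q] (k : ℕ) :
    OrderChains Q (k + 1) →ₗ[ℂ] OrderChains Q k :=
  Finsupp.linearCombination ℂ fun c : Fin (k + 1) ↪o Q =>
    ∑ i : Fin (k + 1), Finsupp.single ((Fin.succAboveOrderEmb i).trans c) ((-1 : ℂ) ^ (i : ℕ))

/-- The cycles of dimension `k - 1`; in dimension `-1` every chain is a cycle. -/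
noncomputable def orderCycles (Q : Type) [PartialOrder Q] : (k : ℕ) → Submodule ℂ (OrderChains Q k)
  | 0 => ⊤
  | k + 1 => LinearMap.ker (orderBoundary Q k)

/-- The boundaries of dimension `k - 1`. -/
noncomputable def orderBoundaries (Q : Type) [PartialOrder Q] (k : ℕ) :
    Submodule ℂ (OrderChains Q k) :=
  LinearMap.range (orderBoundary Q k)

/-- The boundary of a boundary is zero. -/
theorem orderBoundary_orderBoundary (Q : Type) [PartialOrder Q] (k : ℕ) :
    orderBoundary Q k ∘ₗ orderBoundary Q (k + 1) = 0 := by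
  ext c : 2
  simp only [LinearMap.comp_apply, Finsupp.lsingle_apply, orderBoundary,
    Finsupp.linearCombination_single, one_smul, map_sum, LinearMap.zero_apply, Finset.smul_sum,
    Finsupp.smul_single, smul_eq_mul]
  rw [← Finset.sum_product']
  rw [Finset.univ_product_univ]
  refine Finset.sum_ninvolution (fun p => (p.1.succAbove p.2, p.2.predAbove p.1)) ?_ ?_ ?_ ?_
  · rintro ⟨i, j⟩
    have h1 : (Fin.succAboveOrderEmb (j.predAbove i)).trans
        ((Fin.succAboveOrderEmb (i.succAbove j)).trans c) =
        (Fin.succAboveOrderEmb j).trans ((Fin.succAboveOrderEmb i).trans c) := by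
      ext x
      simp [Fin.succAbove_succAbove_succAbove_predAbove]
    have h2 : (-1 : ℂ) ^ ((i.succAbove j : Fin (k + 2)) : ℕ) *
        (-1) ^ ((j.predAbove i : Fin (k + 1)) : ℕ) = - ((-1) ^ (i : ℕ) * (-1) ^ (j : ℕ)) := by
      rw [← pow_add, ← pow_add]
      exact Fin.neg_one_pow_succAbove_add_predAbove i j
    simp only [h1, h2]
    rw [← Finsupp.single_add, add_neg_cancel, Finsupp.single_zero]
  · rintro ⟨i, j⟩ - h
    exact Fin.succAbove_ne i j (congrArg Prod.fst h)
  · intro p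
    exact Finset.mem_univ _
  · rintro ⟨i, j⟩
    exact Prod.ext (Fin.succAbove_succAbove_predAbove i j) (Fin.predAbove_predAbove_succAbove i j)

/-- The action of `G` on chains, given an action of `G` on `Q` by order automorphisms: `g` takes
`x₀ < ⋯ < x_{k-1}` to `g x₀ < ⋯ < g x_{k-1}`. -/
noncomputable def orderChainsRep {G : Type} [Group G] {Q : Type} [PartialOrder Q]
    (α : G →* (Q ≃o Q)) (k : ℕ) : Representation ℂ G (OrderChains Q k) where
  toFun g := Finsupp.lmapDomain ℂ ℂ fun c : Fin k ↪o Q => c.trans (α g).toOrderEmbedding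
  map_one' := by
    ext c : 2
    simp only [map_one, LinearMap.comp_apply, Finsupp.lsingle_apply, Finsupp.lmapDomain_apply,
      Finsupp.mapDomain_single, Module.End.one_apply]
    rfl
  map_mul' g h := by
    ext c : 2
    simp only [map_mul, LinearMap.comp_apply, Finsupp.lsingle_apply, Finsupp.lmapDomain_apply,
      Finsupp.mapDomain_single, Module.End.mul_apply]
    rfl

theorem orderBoundary_orderChainsRep {G : Type} [Group G] {Q : Type} [PartialOrder Q]
    (α : G →* (Q ≃o Q)) (k : ℕ) (g : G) (x : OrderChains Q (k + 1)) :
    orderBoundary Q k (orderChainsRep α (k + 1) g x) =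
      orderChainsRep α k g (orderBoundary Q k x) := by
  have h : orderBoundary Q k ∘ₗ orderChainsRep α (k + 1) g =
      orderChainsRep α k g ∘ₗ orderBoundary Q k := by
    ext c : 2
    simp only [orderBoundary, orderChainsRep, MonoidHom.coe_mk, OneHom.coe_mk,
      LinearMap.comp_apply, Finsupp.lsingle_apply, Finsupp.lmapDomain_apply,
      Finsupp.mapDomain_single, Finsupp.linearCombination_single, one_smul,
      Finsupp.mapDomain_finsetSum]
    rfl
  exact LinearMap.congr_fun h x

theorem orderCycles_invariant {G : Type} [Group G] {Q : Type} [PartialOrder Q]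
    (α : G →* (Q ≃o Q)) (k : ℕ) (g : G) :
    orderCycles Q k ≤ (orderCycles Q k).comap (orderChainsRep α k g) := by
  intro x hx
  cases k with
  | zero => exact Submodule.mem_top
  | succ k =>
    have hx' : orderBoundary Q k x = 0 := hx
    change orderBoundary Q k (orderChainsRep α (k + 1) g x) = 0
    rw [orderBoundary_orderChainsRep, hx', map_zero]

theorem orderBoundaries_invariant {G : Type} [Group G] {Q : Type} [PartialOrder Q]
    (α : G →* (Q ≃o Q)) (k : ℕ) (g : G) :
    orderBoundaries Q k ≤ (orderBoundaries Q k).comap (orderChainsRep α k g) := by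
  rintro x ⟨y, hy⟩
  exact ⟨orderChainsRep α (k + 1) g y,
    (orderBoundary_orderChainsRep α k g y).trans (congrArg (orderChainsRep α k g) hy)⟩

/-- The subquotient representation `Z / (B ∩ Z)` for two invariant subspaces `Z` and `B` of a
representation. -/
noncomputable def subquotientRep {G V : Type} [Group G] [AddCommGroup V] [Module ℂ V]
    (ρ : Representation ℂ G V) (Z B : Submodule ℂ V) (hZ : ∀ g, Z ≤ Z.comap (ρ g))
    (hB : ∀ g, B ≤ B.comap (ρ g)) : Representation ℂ G (Z ⧸ B.submoduleOf Z) :=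
  (ρ.subrepresentation Z hZ).quotient (B.submoduleOf Z) fun g _ hx => hB g hx

/-- The representation of `G` on the reduced homology `H̃_{k-1}(Q; ℂ)` (cycles modulo boundaries)
of the order complex of `Q`. -/
noncomputable def orderHomology {G : Type} [Group G] {Q : Type} [PartialOrder Q]
    (α : G →* (Q ≃o Q)) (k : ℕ) : Rep.{0} ℂ G :=
  Rep.of (subquotientRep (orderChainsRep α k) (orderCycles Q k) (orderBoundaries Q k)
    (orderCycles_invariant α k) (orderBoundaries_invariant α k))

/-! ## The proper part of a bounded poset -/

/-- The proper part of a bounded poset: all elements but the bottom and the top. -/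
abbrev ProperPart (P : Type) [PartialOrder P] [BoundedOrder P] : Type :=
  {x : P // x ≠ ⊥ ∧ x ≠ ⊤}

/-- An action by order automorphisms on a bounded poset restricts to its proper part. -/
def properPartAction {G : Type} [Group G] {P : Type} [PartialOrder P] [BoundedOrder P]
    (α : G →* (P ≃o P)) : G →* (ProperPart P ≃o ProperPart P) where
  toFun g :=
    { toEquiv := (α g).toEquiv.subtypeEquiv fun x => by simp
      map_rel_iff' := (α g).map_rel_iff }
  map_one' := by
    ext x
    change (α 1) x.1 = x.1
    rw [map_one]
    rfl
  map_mul' g h := by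
    ext x
    change (α (g * h)) x.1 = (α g) ((α h) x.1)
    rw [map_mul]
    rfl

open Classical in
/-- The reduced homology `H̃_j(P̄; ℂ)`, for `j : ℤ`, of the proper part `P̄` of a bounded poset `P`
on which `G` acts.  If `P` has more than one element, it is the reduced simplicial homology of
the order complex of `P̄` (which is the complex `{∅}` if `P̄` is empty).  If `P` has only one
element, the complex is by convention the degenerate empty complex, whose homology is the
one-dimensional trivial representation in degree `-2`, and zero in the other degrees. -/
noncomputable def properPartHomology {G : Type} [Group G] {P : Type} [PartialOrder P]
    [BoundedOrder P] (α : G →* (P ≃o P)) (j : ℤ) : Rep.{0} ℂ G :=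
  if (⊥ : P) = ⊤ then
    if j = -2 then Rep.trivial ℂ G ℂ else Rep.trivial ℂ G PUnit
  else
    if -1 ≤ j then orderHomology (properPartAction α) (j + 1).toNat
    else Rep.trivial ℂ G PUnit

/-! ## The partition lattice -/

/-- The lattice of partitions of `{0, …, n-1}`, a partition being given by its equivalence
relation; `r ≤ s` means that `r` refines `s`, the bottom is the partition into singletons and the
top is the partition into one block. -/
abbrev PartitionLattice (n : ℕ) : Type := Setoid (Fin n)

/-- The action of the symmetric group on the partition lattice: the blocks of `σ r` are the images
under `σ` of the blocks of `r`. -/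
def partitionAction (n : ℕ) :
    Equiv.Perm (Fin n) →* (PartitionLattice n ≃o PartitionLattice n) where
  toFun σ :=
    { toFun := fun r => r.comap ⇑σ⁻¹
      invFun := fun r => r.comap ⇑σ
      left_inv := fun r => by ext x y; simp [Setoid.comap_rel]
      right_inv := fun r => by ext x y; simp [Setoid.comap_rel]
      map_rel_iff' := fun {r s} =>
        ⟨fun h x y hxy => by
          have h' : r (σ⁻¹ (σ x)) (σ⁻¹ (σ y)) → s (σ⁻¹ (σ x)) (σ⁻¹ (σ y)) := @h (σ x) (σ y)
          simp only [Equiv.Perm.inv_def, Equiv.symm_apply_apply] at h'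
          exact h' hxy,
        fun h x y hxy => h hxy⟩ }
  map_one' := by
    ext r x y
    rfl
  map_mul' σ τ := by
    ext r x y
    change r ((σ * τ)⁻¹ x) ((σ * τ)⁻¹ y) ↔ r (τ⁻¹ (σ⁻¹ x)) (τ⁻¹ (σ⁻¹ y))
    rw [mul_inv_rev]
    rfl

/-! ## One-dimensional representations -/

/-- The one-dimensional representation with character `χ`. -/
noncomputable def linearCharacterRep {G : Type} [Group G] (χ : G →* ℂˣ) : Representation ℂ G ℂ :=
  ((Algebra.lmul ℂ ℂ : ℂ →* Module.End ℂ ℂ).comp (Units.coeHom ℂ)).comp χ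

/-- The sign representation of the symmetric group on `n` letters. -/
noncomputable def signRep (n : ℕ) : Representation ℂ (Equiv.Perm (Fin n)) ℂ :=
  linearCharacterRep ((Units.map (Int.castRingHom ℂ).toMonoidHom).comp Equiv.Perm.sign)

/-- The subgroup generated by the cycle `(0, 1, …, n-1)`. -/
abbrev cyclicSubgroup (n : ℕ) : Subgroup (Equiv.Perm (Fin n)) :=
  Subgroup.zpowers (finRotate n)

/-- The cycle `(0, 1, …, n-1)` as an element of the subgroup that it generates. -/
def cyclicGenerator (n : ℕ) : cyclicSubgroup n :=
  ⟨finRotate n, Subgroup.mem_zpowers _⟩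

theorem mem_zpowers_cyclicGenerator (n : ℕ) (x : cyclicSubgroup n) :
    x ∈ Subgroup.zpowers (cyclicGenerator n) := by
  obtain ⟨x, k, rfl⟩ := x
  exact ⟨k, Subtype.ext (by simp [cyclicGenerator])⟩

/-- The complex number `e^{2πi/n}` as a unit. -/
noncomputable def rootUnit (n : ℕ) : ℂˣ :=
  Units.mk0 (Complex.exp (2 * Real.pi * Complex.I / n)) (Complex.exp_ne_zero _)

theorem orderOf_rootUnit_dvd (n : ℕ) : orderOf (rootUnit n) ∣ orderOf (cyclicGenerator n) := by
  have hgen : orderOf (cyclicGenerator n) = orderOf (finRotate n) :=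
    Subgroup.orderOf_mk _ _
  rw [hgen]
  match n with
  | 0 =>
    have : rootUnit 0 = 1 := Units.ext (by simp [rootUnit])
    simp [this]
  | 1 =>
    have : rootUnit 1 = 1 := Units.ext (by simp [rootUnit])
    simp [this]
  | n + 2 =>
    rw [isCycle_finRotate.orderOf, support_finRotate, Finset.card_univ, Fintype.card_fin]
    refine orderOf_dvd_of_pow_eq_one (Units.ext ?_)
    have h := (Complex.isPrimitiveRoot_exp (n + 2) (by omega)).pow_eq_one
    simpa [rootUnit] using h

/-- The linear character of the cyclic subgroup whose value at the generating cycle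
is `e^{2πi/n}`. -/
noncomputable def cyclicCharacter (n : ℕ) : cyclicSubgroup n →* ℂˣ :=
  monoidHomOfForallMemZpowers (mem_zpowers_cyclicGenerator n) (orderOf_rootUnit_dvd n)

theorem cyclicCharacter_cyclicGenerator (n : ℕ) :
    (cyclicCharacter n (cyclicGenerator n) : ℂ) = Complex.exp (2 * Real.pi * Complex.I / n) := by
  rw [cyclicCharacter, monoidHomOfForallMemZpowers_apply_gen]
  rfl

/-- The representation of the symmetric group induced from the one-dimensional representation
`e^{2πi/n}` of the cyclic subgroup. -/
noncomputable def lieRep (n : ℕ) :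
    Representation ℂ (Equiv.Perm (Fin n))
      (Representation.IndV (cyclicSubgroup n).subtype (linearCharacterRep (cyclicCharacter n))) :=
  Representation.ind (cyclicSubgroup n).subtype (linearCharacterRep (cyclicCharacter n))

/-! ## Representations of finite groups with equal characters -/

namespace Representation

variable {G V W : Type} [Group G] [AddCommGroup V] [Module ℂ V] [AddCommGroup W] [Module ℂ W]
  {ρ : Representation ℂ G V} {σ : Representation ℂ G W}

/-! Finite-dimensional complex representations of a finite group with equal characters are
isomorphic (`nonempty_equiv_of_character_eq`), so it suffices to compute both characters at each
`g`. Both equal `(-1)^(n-1) * mobius ⊤`, the Möbius number being that of the poset of `g`-invariant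
partitions.

Homology side: the homology of the proper part vanishes below the top degree. This is proved for all
upper intervals by a complementation argument (`acyclicBelow_partition`): for a coatom `a` splitting
off one block, the interval without the complements of `a` is acyclic, and the complements, an
antichain, are attached one at a time along smaller upper intervals. The Hopf trace formula
(`character_orderHomology`) then turns the character into an alternating count of `g`-fixed chains,
that is, of chains of invariant partitions.

Induced side: the character is `n⁻¹ * ∑ j, ψ j * B j`, where `ψ` is the standard additive character
of `ZMod n` and `B j` counts the bijections to `ZMod n` carrying `g` to translation by `j`
(`character_lieRep`). To bring in the Möbius number, count maps to `q` copies of `ZMod n` that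
intertwine `g` with translation by `j`. Möbius inversion over their kernels, which are invariant
partitions, writes the number of injective ones as a polynomial in `q` whose exponents are the
numbers of `g`-orbits on blocks (`sum_mobius_mul_card_label`). A direct count gives zero or `d^m *
(m*q)(m*q-1)⋯(m*q-m+1)`, where `g` has `m` cycles, all of length `d` (`card_injective_colouring`).
In the coefficient of `q`, one side keeps only partitions whose blocks are permuted transitively;
the other is `(-1)^(n-1) * sgn g * B j`.

Finally, sum against `ψ`. A transitive `r ≠ ⊤` contributes zero, since its labellings can be shifted
so as to change `j` by a nonzero amount, while `⊤` contributes `n * mobius ⊤`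
(`card_mul_mobius_top`). The sign twist cancels `sgn g`. -/

theorem exists_intertwining_generalized_inverse [Finite G] (f : IntertwiningMap ρ σ) :
    ∃ t : IntertwiningMap σ ρ, ∀ x, f (t (f x)) = f x := by
  have := Fintype.ofFinite G
  obtain ⟨s, hs⟩ := f.toLinearMap.rangeRestrict.exists_rightInverse_of_surjective
    f.toLinearMap.range_rangeRestrict
  obtain ⟨t, ht⟩ := LinearMap.exists_extend s
  have hft : ∀ x, f (t (f x)) = f x := fun x => by
    have h1 : t (f x) = s ⟨f x, LinearMap.mem_range_self f.toLinearMap x⟩ :=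
      LinearMap.congr_fun ht ⟨f x, LinearMap.mem_range_self f.toLinearMap x⟩
    rw [h1]
    exact congrArg Subtype.val (LinearMap.congr_fun hs
      ⟨f x, LinearMap.mem_range_self f.toLinearMap x⟩)
  have hc : (Fintype.card G : ℂ) ≠ 0 := Nat.cast_ne_zero.2 Fintype.card_ne_zero
  -- Averaging over the group makes `t` equivariant. The identity `f t f = f` survives because every
  -- conjugate of `t` satisfies it.
  let T : W →ₗ[ℂ] V := (Fintype.card G : ℂ)⁻¹ • ∑ g : G, ρ g ∘ₗ t ∘ₗ σ g⁻¹
  have hT : ∀ x, T x = (Fintype.card G : ℂ)⁻¹ • ∑ g : G, ρ g (t (σ g⁻¹ x)) := fun x => by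
    simp [T]
  refine ⟨T.intertwiningMap_of_isIntertwiningMap σ ρ fun g x => ?_, fun x => ?_⟩
  · rw [hT, hT, map_smul, map_sum]
    congr 1
    refine Fintype.sum_equiv (Equiv.mulLeft g⁻¹) _ _ fun h => ?_
    rw [← Module.End.mul_apply, ← map_mul, ← Module.End.mul_apply (ρ g), ← map_mul]
    simp
  · change f (T (f x)) = f x
    rw [hT, map_smul, map_sum]
    have : ∀ g : G, f (ρ g (t (σ g⁻¹ (f x)))) = f x := fun g => by
      rw [f.isIntertwining, ← f.isIntertwining _ _ g⁻¹ x, hft, f.isIntertwining,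
        ← Module.End.mul_apply,
        ← map_mul]
      simp
    simp only [this, Finset.sum_const, Finset.card_univ, ← Nat.cast_smul_eq_nsmul ℂ, smul_smul]
    rw [inv_mul_cancel₀ hc, one_smul]

/-- Equal characters give the Hom spaces from `κ = ker f` to `ρ` and to `σ` the same dimension.
Composition with `f` kills the inclusion of `κ`, so it is not surjective. A map `u : κ → σ` that
does not factor through `f`, corrected by `1 - f t`, is added to `f` to shrink the kernel. -/
theorem exists_intertwining_ker_lt [Finite G] [FiniteDimensional ℂ V] [FiniteDimensional ℂ W]
    (h : ρ.character = σ.character) (f : IntertwiningMap ρ σ)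
    (hf : LinearMap.ker f.toLinearMap ≠ ⊥) :
    ∃ f' : IntertwiningMap ρ σ, LinearMap.ker f'.toLinearMap < LinearMap.ker f.toLinearMap := by
  have := Fintype.ofFinite G
  have hc : (Nat.card G : ℂ) ≠ 0 := Nat.cast_ne_zero.2 Nat.card_pos.ne'
  have := invertibleOfNonzero hc
  obtain ⟨t, ht⟩ := exists_intertwining_generalized_inverse f
  let K := LinearMap.ker f.toLinearMap
  have hK : ∀ g, K ≤ K.comap (ρ g) := fun g x hx => by
    have hx' : f x = 0 := hx
    change f (ρ g x) = 0
    rw [f.isIntertwining, hx', map_zero]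
  let κ := ρ.subrepresentation K hK
  let ι : IntertwiningMap κ ρ := K.subtype.intertwiningMap_of_isIntertwiningMap κ ρ fun _ _ => rfl
  let p : IntertwiningMap ρ κ :=
    (LinearMap.codRestrict K (LinearMap.id - t.toLinearMap ∘ₗ f.toLinearMap)
      fun x => by
        change f (x - t (f x)) = 0
        rw [map_sub, ht, sub_self]).intertwiningMap_of_isIntertwiningMap ρ κ fun g x =>
          Subtype.ext (by
            change ρ g x - t (f (ρ g x)) = ρ g (x - t (f x))
            rw [f.isIntertwining, t.isIntertwining, map_sub])
  have hp : ∀ x : K, p x = x := fun x => Subtype.ext (by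
    have hx : f (x : V) = 0 := x.2
    change (x : V) - t (f (x : V)) = x
    rw [hx, map_zero, sub_zero])
  have hdim : Module.finrank ℂ (IntertwiningMap κ ρ) = Module.finrank ℂ (IntertwiningMap κ σ) := by
    have h1 := card_inv_mul_sum_char_mul_char_eq_finrank κ ρ
    have h2 := card_inv_mul_sum_char_mul_char_eq_finrank κ σ
    rw [h, h2] at h1
    exact_mod_cast h1.symm
  let Φ : IntertwiningMap κ ρ →ₗ[ℂ] IntertwiningMap κ σ :=
    { toFun := fun u => f.comp u
      map_add' := fun u v => by ext; simp
      map_smul' := fun a u => by ext; simp }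
  have hΦ : ¬ Function.Surjective Φ := by
    intro hs
    have hi := (LinearMap.injective_iff_surjective_of_finrank_eq_finrank hdim).2 hs
    apply hf
    rw [Submodule.eq_bot_iff]
    intro x hx
    have h0 : ι = 0 := hi (by
      ext y
      have hy : f (y : V) = 0 := y.2
      change f (y : V) = f (0 : V)
      rw [hy, map_zero])
    have := congrArg (fun u : IntertwiningMap κ ρ => u ⟨x, hx⟩) h0
    exact this
  rw [Function.Surjective] at hΦ
  push Not at hΦ
  obtain ⟨u, hu⟩ := hΦ
  have hq : ∃ x, u x - f (t (u x)) ≠ 0 := by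
    by_contra! hcon
    refine hu (t.comp u) ?_
    ext x
    exact (sub_eq_zero.1 (hcon x)).symm
  obtain ⟨x, hx⟩ := hq
  let f' : IntertwiningMap ρ σ := f + (u.comp p - f.comp (t.comp (u.comp p)))
  have hf' : ∀ y, f' y = f y + (u (p y) - f (t (u (p y)))) := fun y => rfl
  -- Since `f t (1 - f t) = 0`, applying `f t` to `f'` recovers `f`.
  have hle : ∀ y, f' y = 0 → f y = 0 := by
    intro y hy
    have h1 := congrArg (fun z => f (t z)) hy
    simpa [hf', ht] using h1
  refine ⟨f', lt_of_le_of_ne hle fun heq => hx ?_⟩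
  have hx1 : f (x : V) = 0 := x.2
  have hx2 : f' (x : V) = 0 := by
    have : (x : V) ∈ LinearMap.ker f'.toLinearMap := by
      rw [heq]; exact x.2
    exact this
  rw [hf', hp, hx1, zero_add] at hx2
  exact hx2

/-- Two finite-dimensional complex representations of a finite group with the same character are
isomorphic. -/
theorem nonempty_equiv_of_character_eq [Finite G] [FiniteDimensional ℂ V] [FiniteDimensional ℂ W]
    (h : ρ.character = σ.character) : Nonempty (ρ.Equiv σ) := by
  obtain ⟨f, -, hf⟩ := WellFounded.has_min
    (measure fun f : IntertwiningMap ρ σ => Module.finrank ℂ (LinearMap.ker f.toLinearMap)).wf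
    Set.univ Set.univ_nonempty
  by_cases hk : LinearMap.ker f.toLinearMap = ⊥
  · have hd : Module.finrank ℂ V = Module.finrank ℂ W := by
      have h1 := congrFun h 1
      rw [char_one, char_one] at h1
      exact_mod_cast h1
    have hi : Function.Injective f.toLinearMap := LinearMap.ker_eq_bot.1 hk
    exact ⟨f.ofBijective ⟨hi,
      (LinearMap.injective_iff_surjective_of_finrank_eq_finrank hd).1 hi⟩⟩
  · obtain ⟨f', hf'⟩ := exists_intertwining_ker_lt h f hk
    exact absurd (Submodule.finrank_lt_finrank_of_lt hf') (hf f' (Set.mem_univ f'))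

/-- The trace on the coinvariants of an endomorphism induced from one that commutes with the
action. -/
theorem trace_coinvariants [Fintype G] [FiniteDimensional ℂ V] (ρ : Representation ℂ G V)
    (a : V →ₗ[ℂ] V) (b : ρ.Coinvariants →ₗ[ℂ] ρ.Coinvariants)
    (hb : ∀ x, b (Coinvariants.mk ρ x) = Coinvariants.mk ρ (a x)) :
    LinearMap.trace ℂ _ b =
      (Fintype.card G : ℂ)⁻¹ * ∑ g : G, LinearMap.trace ℂ V (ρ g ∘ₗ a) := by
  have hc : (Fintype.card G : ℂ) ≠ 0 := Nat.cast_ne_zero.2 Fintype.card_ne_zero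
  -- The averaging projector factors through the coinvariants as `s ∘ q`, so the trace of `b = q ∘ a
  -- ∘ s` is that of `P ∘ a`.
  let P : V →ₗ[ℂ] V := (Fintype.card G : ℂ)⁻¹ • ∑ g : G, ρ g
  have hP : ∀ h, P ∘ₗ ρ h = P := fun h => by
    ext x
    simp only [P, LinearMap.comp_apply, LinearMap.smul_apply, LinearMap.sum_apply]
    congr 1
    refine Fintype.sum_equiv (Equiv.mulRight h) _ _ fun g => ?_
    simp
  let s := Coinvariants.lift ρ P hP
  let q := Coinvariants.mk ρ
  have hqs : q ∘ₗ s = LinearMap.id := by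
    refine Coinvariants.hom_ext ?_
    ext x
    have : s (q x) = P x := rfl
    simp only [LinearMap.comp_apply, LinearMap.id_apply]
    change q (s (q x)) = q x
    rw [this]
    simp only [P, LinearMap.smul_apply, LinearMap.sum_apply, map_smul, map_sum]
    have h2 : ∀ g, q (ρ g x) = q x := fun g => Coinvariants.mk_self_apply ρ g x
    simp only [h2, Finset.sum_const, Finset.card_univ, ← Nat.cast_smul_eq_nsmul ℂ, smul_smul]
    rw [inv_mul_cancel₀ hc, one_smul]
  have hbq : b = q ∘ₗ (a ∘ₗ s) := by
    calc b = b ∘ₗ (q ∘ₗ s) := by rw [hqs, LinearMap.comp_id]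
      _ = q ∘ₗ (a ∘ₗ s) := by
        ext x
        exact hb _
  have hsq : s ∘ₗ q = P := Coinvariants.lift_comp_mk ρ P hP
  rw [hbq, LinearMap.trace_comp_comm', LinearMap.comp_assoc, hsq, LinearMap.trace_comp_comm']
  have hPa : P ∘ₗ a = (Fintype.card G : ℂ)⁻¹ • ∑ g : G, ρ g ∘ₗ a := by
    ext x
    simp [P]
  rw [hPa, map_smul, map_sum, smul_eq_mul]

end Representation

/-! ### Traces in exact sequences and on permutation modules. -/

namespace LinearMap

variable {V W : Type*} [AddCommGroup V] [Module ℂ V] [AddCommGroup W] [Module ℂ W]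

/-- The trace is additive in short exact sequences. -/
theorem trace_eq_trace_restrict_ker_add [FiniteDimensional ℂ V] [FiniteDimensional ℂ W]
    (f : V →ₗ[ℂ] W) (hf : Function.Surjective f) (a : V →ₗ[ℂ] V) (b : W →ₗ[ℂ] W)
    (hab : f ∘ₗ a = b ∘ₗ f) (ha : ∀ x ∈ ker f, a x ∈ ker f) :
    trace ℂ V a = trace ℂ (ker f) (a.restrict ha) + trace ℂ W b := by
  obtain ⟨s, hs⟩ := f.exists_rightInverse_of_surjective (range_eq_top.2 hf)
  have hs' : ∀ y, f (s y) = y := fun y => LinearMap.congr_fun hs y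
  let p : V →ₗ[ℂ] ker f := codRestrict (ker f) (id - s ∘ₗ f) fun x => by
    simp [hs']
  have h1 : a.restrict ha = p ∘ₗ (a ∘ₗ (ker f).subtype) := by
    ext x
    have h2 : f (a x) = 0 := ha x x.2
    simp [p, h2]
  have h2 : b = f ∘ₗ (a ∘ₗ s) := by
    rw [← comp_assoc, hab, comp_assoc, hs, comp_id]
  rw [h1, h2, trace_comp_comm', trace_comp_comm' (a ∘ₗ s) f, ← map_add]
  congr 1
  ext x
  simp [p]

theorem trace_finsupp_lmapDomain {ι : Type*} [Finite ι] (π : ι → ι) :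
    trace ℂ (ι →₀ ℂ) (Finsupp.lmapDomain ℂ ℂ π) = Nat.card {i // π i = i} := by
  classical
  have := Fintype.ofFinite ι
  rw [trace_eq_matrix_trace ℂ (Finsupp.basisSingleOne (R := ℂ) (ι := ι)), Matrix.trace,
    Nat.card_eq_fintype_card, Fintype.card_subtype, Finset.card_filter, Nat.cast_sum]
  refine Finset.sum_congr rfl fun i _ => ?_
  simp [toMatrix_apply, Finsupp.mapDomain_single, Finsupp.single_apply]

end LinearMap

/-! ### Characters of linear and induced representations. -/

open scoped MonoidAlgebra

theorem trace_linearCharacterRep {G : Type} [Group G] (χ : G →* ℂˣ) (g : G) :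
    LinearMap.trace ℂ ℂ (linearCharacterRep χ g) = χ g := by
  have h : linearCharacterRep χ g = ((χ g : ℂˣ) : ℂ) • LinearMap.id := by
    ext
    simp [linearCharacterRep]
  rw [h, map_smul, LinearMap.trace_id]
  simp

theorem trace_leftRegular_comp_mulRight {G : Type} [Group G] [Finite G] (h g : G) :
    LinearMap.trace ℂ ℂ[G] (Representation.leftRegular ℂ G h ∘ₗ
      MonoidAlgebra.mapDomainLinearMap ℂ ℂ fun x => x * g) = Nat.card {x : G // h * x * g = x} := by
  rw [← LinearMap.trace_conj' _ (MonoidAlgebra.coeffLinearEquiv ℂ),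
    ← LinearMap.trace_finsupp_lmapDomain]
  congr 1
  ext x : 2
  simp [LinearEquiv.conj_apply, mul_assoc]

/-- The character of a representation induced from a linear character of a subgroup. -/
theorem character_ind_linearCharacterRep {G : Type} [Group G] [Finite G] (H : Subgroup G)
    [Fintype H] (χ : H →* ℂˣ) (g : G) :
    (Representation.ind H.subtype (linearCharacterRep χ)).character g =
      (Fintype.card H : ℂ)⁻¹ * ∑ h : H, (Nat.card {x : G // x * g * x⁻¹ = h} : ℂ) * (χ h : ℂ) := by
  -- The induced representation consists of the coinvariants of `H` on `ℂ[G] ⊗ χ`, with `g` acting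
  -- through right multiplication by `g⁻¹`.
  rw [Representation.character, Representation.trace_coinvariants _
    ((MonoidAlgebra.mapDomainLinearMap ℂ ℂ fun x => x * g⁻¹).rTensor ℂ) _ fun x => rfl]
  congr 1
  refine Finset.sum_congr rfl fun h _ => ?_
  have h1 : Representation.tprod ((Representation.leftRegular ℂ G).comp H.subtype)
      (linearCharacterRep χ) h ∘ₗ
        (MonoidAlgebra.mapDomainLinearMap ℂ ℂ fun x => x * g⁻¹).rTensor ℂ =
      TensorProduct.map (Representation.leftRegular ℂ G h ∘ₗ
        MonoidAlgebra.mapDomainLinearMap ℂ ℂ fun x => x * g⁻¹) (linearCharacterRep χ h) := by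
    ext
    simp
  have : Module.Finite ℂ ℂ[G] := Module.Finite.equiv (MonoidAlgebra.coeffLinearEquiv ℂ).symm
  have : Module.Free ℂ ℂ[G] := Module.Free.of_equiv (MonoidAlgebra.coeffLinearEquiv ℂ).symm
  rw [h1, LinearMap.trace_tensorProduct', trace_leftRegular_comp_mulRight, trace_linearCharacterRep]
  congr 2
  refine Nat.card_congr (Equiv.subtypeEquivRight fun x => ?_)
  rw [mul_inv_eq_iff_eq_mul, mul_inv_eq_iff_eq_mul, eq_comm]

/-! ## Acyclicity of order complexes of subsets of a poset -/

section Acyclic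

variable {P : Type} [PartialOrder P]

/-- The chains of the order complex of `P` that are supported on simplices inside `S`. -/
noncomputable def chainsIn (S : Set P) (k : ℕ) : Submodule ℂ (OrderChains P k) :=
  Finsupp.supported ℂ ℂ {c | ∀ i, c i ∈ S}

theorem mem_chainsIn {S : Set P} {k : ℕ} {z : OrderChains P k} :
    z ∈ chainsIn S k ↔ ∀ c, z c ≠ 0 → ∀ i, c i ∈ S := by
  simp [chainsIn, Finsupp.mem_supported, Set.subset_def]

theorem single_mem_chainsIn {S : Set P} {k : ℕ} {c : Fin k ↪o P} (hc : ∀ i, c i ∈ S) (a : ℂ) :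
    Finsupp.single c a ∈ chainsIn S k :=
  Finsupp.single_mem_supported ℂ a hc

theorem chainsIn_mono {S T : Set P} (h : S ⊆ T) (k : ℕ) : chainsIn S k ≤ chainsIn T k :=
  Finsupp.supported_mono fun _ hc i => h (hc i)

theorem chainsIn_zero_le (S T : Set P) : chainsIn S 0 ≤ chainsIn T 0 :=
  Finsupp.supported_mono fun _ _ i => i.elim0

theorem chainsIn_le_iff {S : Set P} {k : ℕ} {M : Submodule ℂ (OrderChains P k)} :
    chainsIn S k ≤ M ↔ ∀ c : Fin k ↪o P, (∀ i, c i ∈ S) → Finsupp.single c 1 ∈ M := by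
  rw [chainsIn, Finsupp.supported_eq_span_single, Submodule.span_le]
  simp [Set.subset_def]

/-- The face of a chain opposite to the `i`-th vertex. -/
def face {k : ℕ} (c : Fin (k + 1) ↪o P) (i : Fin (k + 1)) : Fin k ↪o P :=
  (Fin.succAboveOrderEmb i).trans c

@[simp] theorem face_apply {k : ℕ} (c : Fin (k + 1) ↪o P) (i : Fin (k + 1)) (j : Fin k) :
    face c i j = c (i.succAbove j) := rfl

theorem face_property {k : ℕ} {p : P → Prop} {c : Fin (k + 1) ↪o P} (hc : ∀ i, p (c i))
    (i : Fin (k + 1)) (j : Fin k) : p (face c i j) := hc _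

theorem orderBoundary_single (k : ℕ) (c : Fin (k + 1) ↪o P) :
    orderBoundary P k (Finsupp.single c 1) = ∑ i : Fin (k + 1),
      Finsupp.single (face c i) ((-1 : ℂ) ^ (i : ℕ)) := by
  simp [orderBoundary, face]

theorem orderBoundary_mem_chainsIn {S : Set P} {k : ℕ} {z : OrderChains P (k + 1)}
    (hz : z ∈ chainsIn S (k + 1)) : orderBoundary P k z ∈ chainsIn S k := by
  refine (chainsIn_le_iff (M := (chainsIn S k).comap (orderBoundary P k))).2 (fun c hc => ?_) hz
  rw [Submodule.mem_comap, orderBoundary_single]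
  exact Submodule.sum_mem _ fun i _ => single_mem_chainsIn (face_property hc i) _

theorem orderBoundary_orderBoundary_apply (k : ℕ) (z : OrderChains P (k + 2)) :
    orderBoundary P k (orderBoundary P (k + 1) z) = 0 :=
  LinearMap.congr_fun (orderBoundary_orderBoundary P k) z

/-- The reduced homology of the order complex of `S` vanishes on chains with fewer than `m`
elements. -/
def AcyclicBelow (S : Set P) (m : ℕ) : Prop :=
  ∀ k < m, ∀ z ∈ chainsIn S k, z ∈ orderCycles P k →
    ∃ w ∈ chainsIn S (k + 1), orderBoundary P k w = z

/-- A way to adjoin an element `x` to the chains in `T`, with signs making it a cone operator. -/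
structure ChainJoin (x : P) (T : Set P) where
  join : ∀ k (c : Fin k ↪o P), (∀ i, c i ∈ T) → (Fin (k + 1) ↪o P)
  sign : ℕ → ℂ
  sign_ne_zero : ∀ k, sign k ≠ 0
  exists_eq : ∀ k c hc, ∃ i, join k c hc i = x
  eq_or_mem : ∀ k c hc i, join k c hc i = x ∨ join k c hc i ∈ T
  join_injective : ∀ k c hc c' hc', join k c hc = join k c' hc' → c = c'
  boundary_zero : ∀ c hc, orderBoundary P 0 (Finsupp.single (join 0 c hc) (sign 0)) =
    Finsupp.single c 1
  boundary_succ : ∀ k c (hc : ∀ i, c i ∈ T),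
    orderBoundary P (k + 1) (Finsupp.single (join (k + 1) c hc) (sign (k + 1))) =
      Finsupp.single c 1 - ∑ i : Fin (k + 1), Finsupp.single
        (join k (face c i) (face_property hc i)) ((-1 : ℂ) ^ (i : ℕ) * sign k)

namespace ChainJoin

variable {x : P} {T : Set P} (J : ChainJoin x T)

open Classical in
/-- The cone operator of a `ChainJoin`. -/
noncomputable def cone (k : ℕ) : OrderChains P k →ₗ[ℂ] OrderChains P (k + 1) :=
  Finsupp.linearCombination ℂ fun c : Fin k ↪o P =>
    if hc : ∀ i, c i ∈ T then Finsupp.single (J.join k c hc) (J.sign k) else 0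

theorem cone_single {k : ℕ} {c : Fin k ↪o P} (hc : ∀ i, c i ∈ T) (a : ℂ) :
    J.cone k (Finsupp.single c a) = Finsupp.single (J.join k c hc) (a * J.sign k) := by
  simp [cone, hc]

theorem boundary_cone_zero {w : OrderChains P 0} (hw : w ∈ chainsIn T 0) :
    orderBoundary P 0 (J.cone 0 w) = w := by
  refine (chainsIn_le_iff (M := LinearMap.eqLocus (orderBoundary P 0 ∘ₗ J.cone 0)
    LinearMap.id)).2 (fun c hc => ?_) hw
  simp only [LinearMap.mem_eqLocus, LinearMap.comp_apply, LinearMap.id_apply]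
  rw [J.cone_single hc, one_mul, J.boundary_zero]

theorem boundary_cone_succ {k : ℕ} {w : OrderChains P (k + 1)} (hw : w ∈ chainsIn T (k + 1)) :
    orderBoundary P (k + 1) (J.cone (k + 1) w) = w - J.cone k (orderBoundary P k w) := by
  refine (chainsIn_le_iff (M := LinearMap.eqLocus (orderBoundary P (k + 1) ∘ₗ J.cone (k + 1))
    (LinearMap.id - J.cone k ∘ₗ orderBoundary P k))).2 (fun c hc => ?_) hw
  simp only [LinearMap.mem_eqLocus, LinearMap.comp_apply, LinearMap.id_apply, LinearMap.sub_apply]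
  rw [J.cone_single hc, one_mul, J.boundary_succ, orderBoundary_single, map_sum]
  congr 1
  refine Finset.sum_congr rfl fun i _ => ?_
  rw [J.cone_single (face_property hc i)]

theorem cone_mem {S : Set P} (hx : x ∈ S) (hT : T ⊆ S) {k : ℕ} {w : OrderChains P k}
    (hw : w ∈ chainsIn T k) : J.cone k w ∈ chainsIn S (k + 1) := by
  refine (chainsIn_le_iff (M := (chainsIn S (k + 1)).comap (J.cone k))).2 (fun c hc => ?_) hw
  rw [Submodule.mem_comap, J.cone_single hc]
  refine single_mem_chainsIn (fun i => ?_) _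
  rcases J.eq_or_mem k c hc i with h | h
  · rwa [h]
  · exact hT h

theorem cone_apply_join {k : ℕ} {w : OrderChains P k} (hw : w ∈ chainsIn T k) {c : Fin k ↪o P}
    (hc : ∀ i, c i ∈ T) : J.cone k w (J.join k c hc) = w c * J.sign k := by
  refine (chainsIn_le_iff (M := LinearMap.eqLocus (Finsupp.lapply (J.join k c hc) ∘ₗ J.cone k)
    (J.sign k • Finsupp.lapply c))).2 (fun c' hc' => ?_) hw |>.trans ?_
  · classical
    simp only [LinearMap.mem_eqLocus, LinearMap.comp_apply, LinearMap.smul_apply]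
    rw [J.cone_single hc']
    by_cases h : c' = c
    · subst h
      simp
    · have h' : J.join k c' hc' ≠ J.join k c hc := fun h' => h (J.join_injective _ _ _ _ _ h')
      simp [h, h']
  · simp [mul_comm]

/-- Every simplex of a cone contains `x`, and distinct simplices have distinct joins, so nothing can
cancel. -/
theorem eq_zero_of_cone_mem {S : Set P} (hx : x ∉ S) {k : ℕ} {w : OrderChains P k}
    (hw : w ∈ chainsIn T k) (h : J.cone k w ∈ chainsIn S (k + 1)) : w = 0 := by
  ext c
  by_contra hc
  have hcT := mem_chainsIn.1 hw c hc
  have h1 : J.cone k w (J.join k c hcT) ≠ 0 := by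
    rw [J.cone_apply_join hw]
    exact mul_ne_zero hc (J.sign_ne_zero k)
  obtain ⟨i, hi⟩ := J.exists_eq k c hcT
  exact hx (hi ▸ mem_chainsIn.1 h _ h1 i)

/-- If `T` is the link of `x` in `S`, then the reduced homology of `S` vanishes below a degree if
that of `S \ {x}` and that of `T`, in one degree less, do. -/
theorem acyclicBelow {S : Set P} (hx : x ∈ S) (hT : T ⊆ S \ {x})
    (hJ : ∀ k (c : Fin (k + 1) ↪o P), (∀ i, c i ∈ S) → (∃ i, c i = x) →
      ∃ c' hc', J.join k c' hc' = c)
    {m : ℕ} (h1 : AcyclicBelow (S \ {x}) (m + 1)) (h2 : AcyclicBelow T m) :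
    AcyclicBelow S (m + 1) := by
  have hxS : x ∉ S \ {x} := fun h => h.2 rfl
  have hTS : T ⊆ S := hT.trans Set.sdiff_subset
  intro k hk z hz hcyc
  cases k with
  | zero =>
    obtain ⟨w, hw, hwz⟩ := h1 0 hk z (chainsIn_zero_le _ _ hz) hcyc
    exact ⟨w, chainsIn_mono Set.sdiff_subset _ hw, hwz⟩
  | succ k =>
    -- Simplices are sorted by whether they contain `x`; those that do are joins of `x` with
    -- simplices of the link.
    have hdec : chainsIn S (k + 1) ≤ chainsIn (S \ {x}) (k + 1) ⊔
        (chainsIn T k).map (J.cone k) := by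
      refine chainsIn_le_iff.2 fun c hc => ?_
      by_cases hcx : ∃ i, c i = x
      · obtain ⟨c', hc', rfl⟩ := hJ k c hc hcx
        refine Submodule.mem_sup_right (Submodule.mem_map.2
          ⟨Finsupp.single c' (J.sign k)⁻¹, single_mem_chainsIn hc' _, ?_⟩)
        rw [J.cone_single hc', inv_mul_cancel₀ (J.sign_ne_zero k)]
      · push Not at hcx
        exact Submodule.mem_sup_left (single_mem_chainsIn (S := S \ {x}) (fun i => ⟨hc i, hcx i⟩) _)
    obtain ⟨z', hz', y, hy, rfl⟩ := Submodule.mem_sup.1 (hdec hz)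
    obtain ⟨w, hw, rfl⟩ := hy
    have hcyc' : orderBoundary P k (z' + J.cone k w) = 0 := hcyc
    -- In positive degree, the cycle condition makes the cone over `∂w` equal to a chain avoiding
    -- `x`, so `∂w = 0`.
    have hwc : w ∈ orderCycles P k := by
      cases k with
      | zero => exact Submodule.mem_top
      | succ k =>
        refine J.eq_zero_of_cone_mem hxS (orderBoundary_mem_chainsIn hw) ?_
        have h3 : J.cone k (orderBoundary P k w) = orderBoundary P (k + 1) z' + w := by
          rw [map_add, J.boundary_cone_succ hw] at hcyc'
          rw [← sub_eq_zero, ← neg_eq_zero, ← hcyc']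
          abel
        rw [h3]
        exact Submodule.add_mem _ (orderBoundary_mem_chainsIn hz') (chainsIn_mono hT _ hw)
    obtain ⟨u, hu, huw⟩ := h2 k (by omega) w hw hwc
    -- Replacing the cone over `w` by a filling `u` of `w` in the link changes `z` by a boundary and
    -- moves it off `x`.
    have h4 : z' + u = z' + J.cone k w + orderBoundary P (k + 1) (J.cone (k + 1) u) := by
      rw [J.boundary_cone_succ hu, huw]
      abel
    obtain ⟨v, hv, hvz⟩ := h1 (k + 1) hk (z' + u)
      (Submodule.add_mem _ hz' (chainsIn_mono hT _ hu)) (by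
        change orderBoundary P k (z' + u) = 0
        rw [h4, map_add, hcyc', orderBoundary_orderBoundary_apply, add_zero])
    refine ⟨v - J.cone (k + 1) u, Submodule.sub_mem _ (chainsIn_mono Set.sdiff_subset _ hv)
      (J.cone_mem hx hTS hu), ?_⟩
    rw [map_sub, hvz, h4]
    abel

end ChainJoin

/-- Adjoining a least element to a chain. -/
def consChain (x : P) (k : ℕ) (c : Fin k ↪o P) (hc : ∀ i, x < c i) : Fin (k + 1) ↪o P :=
  OrderEmbedding.ofStrictMono (Fin.cons x c) (by
    intro i j hij
    cases j using Fin.cases with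
    | zero => exact absurd hij (Fin.not_lt_zero i)
    | succ j =>
      cases i using Fin.cases with
      | zero => simpa using hc j
      | succ i => simpa using hij)

/-- Adjoining a greatest element to a chain. -/
def snocChain (x : P) (k : ℕ) (c : Fin k ↪o P) (hc : ∀ i, c i < x) : Fin (k + 1) ↪o P :=
  OrderEmbedding.ofStrictMono (Fin.snoc (α := fun _ => P) c x) (by
    intro i j hij
    cases i using Fin.lastCases with
    | last => exact absurd hij (Fin.le_last j).not_gt
    | cast i =>
      cases j using Fin.lastCases with
      | last => simpa using hc i
      | cast j => simpa using hij)

@[simp] theorem consChain_zero (x : P) (k : ℕ) (c : Fin k ↪o P) (hc : ∀ i, x < c i) :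
    consChain x k c hc 0 = x := rfl

@[simp] theorem consChain_succ (x : P) (k : ℕ) (c : Fin k ↪o P) (hc : ∀ i, x < c i) (i : Fin k) :
    consChain x k c hc i.succ = c i := rfl

@[simp] theorem snocChain_last (x : P) (k : ℕ) (c : Fin k ↪o P) (hc : ∀ i, c i < x) :
    snocChain x k c hc (Fin.last k) = x := by
  change Fin.snoc (α := fun _ => P) c x (Fin.last k) = x
  simp

@[simp] theorem snocChain_castSucc (x : P) (k : ℕ) (c : Fin k ↪o P) (hc : ∀ i, c i < x)
    (i : Fin k) : snocChain x k c hc i.castSucc = c i := by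
  change Fin.snoc (α := fun _ => P) c x i.castSucc = c i
  simp

theorem succAbove_zero_trans_consChain (x : P) (k : ℕ) (c : Fin k ↪o P) (hc : ∀ i, x < c i) :
    face (consChain x k c hc) 0 = c := by
  ext i
  simp

theorem succAbove_succ_trans_consChain (x : P) (k : ℕ) (c : Fin (k + 1) ↪o P)
    (hc : ∀ i, x < c i) (i : Fin (k + 1)) :
    face (consChain x (k + 1) c hc) i.succ =
      consChain x k (face c i) (face_property (p := (x < ·)) hc i) := by
  ext j
  cases j using Fin.cases <;> simp

theorem succAbove_last_trans_snocChain (x : P) (k : ℕ) (c : Fin k ↪o P) (hc : ∀ i, c i < x) :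
    face (snocChain x k c hc) (Fin.last k) = c := by
  ext i
  simp

theorem succAbove_castSucc_trans_snocChain (x : P) (k : ℕ) (c : Fin (k + 1) ↪o P)
    (hc : ∀ i, c i < x) (i : Fin (k + 1)) :
    face (snocChain x (k + 1) c hc) i.castSucc =
      snocChain x k (face c i) (face_property (p := (· < x)) hc i) := by
  ext j
  cases j using Fin.lastCases <;> simp [Fin.castSucc_succAbove_castSucc]

/-- Adjoining `x` to chains of elements above `x`. -/
noncomputable def consJoin (x : P) (T : Set P) (hT : ∀ y ∈ T, x < y) : ChainJoin x T where
  join k c hc := consChain x k c fun i => hT _ (hc i)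
  sign _ := 1
  sign_ne_zero _ := one_ne_zero
  exists_eq k c hc := ⟨0, rfl⟩
  eq_or_mem k c hc i := by
    cases i using Fin.cases with
    | zero => exact Or.inl rfl
    | succ i => exact Or.inr (hc i)
  join_injective k c hc c' hc' h := by
    ext i
    simpa using DFunLike.congr_fun h i.succ
  boundary_zero c hc := by
    rw [orderBoundary_single, Fin.sum_univ_one, succAbove_zero_trans_consChain]
    simp
  boundary_succ k c hc := by
    rw [orderBoundary_single, Fin.sum_univ_succ, succAbove_zero_trans_consChain]
    simp only [succAbove_succ_trans_consChain, Fin.val_zero, pow_zero, Fin.val_succ, pow_succ,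
      mul_neg, mul_one, Finsupp.single_neg, Finset.sum_neg_distrib]
    abel

/-- Adjoining `x` to chains of elements below `x`. -/
noncomputable def snocJoin (x : P) (T : Set P) (hT : ∀ y ∈ T, y < x) : ChainJoin x T where
  join k c hc := snocChain x k c fun i => hT _ (hc i)
  -- The new vertex has index `k`, so this normalizes the coefficient of the face that omits it to
  -- `1`.
  sign k := (-1) ^ k
  sign_ne_zero k := pow_ne_zero k (by norm_num)
  exists_eq k c hc := ⟨Fin.last k, snocChain_last _ _ _ _⟩
  eq_or_mem k c hc i := by
    cases i using Fin.lastCases with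
    | last => exact Or.inl (snocChain_last _ _ _ _)
    | cast i => exact Or.inr (by simpa using hc i)
  join_injective k c hc c' hc' h := by
    ext i
    simpa using DFunLike.congr_fun h i.castSucc
  boundary_zero c hc := by
    rw [pow_zero, orderBoundary_single, Fin.sum_univ_one]
    rw [show (0 : Fin 1) = Fin.last 0 from rfl, succAbove_last_trans_snocChain]
    simp
  boundary_succ k c hc := by
    have h (c' : Fin (k + 1 + 1) ↪o P) : (Finsupp.single c' ((-1) ^ (k + 1)) : OrderChains P _) =
        (-1 : ℂ) ^ (k + 1) • Finsupp.single c' 1 := by simp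
    rw [h, map_smul, orderBoundary_single, Fin.sum_univ_castSucc, succAbove_last_trans_snocChain]
    simp only [succAbove_castSucc_trans_snocChain, Fin.val_castSucc, Fin.val_last, smul_add,
      Finsupp.smul_single, smul_eq_mul, Finset.smul_sum]
    have h2 : (-1 : ℂ) ^ (k + 1) * (-1) ^ (k + 1) = 1 := by
      rw [← pow_add, Even.neg_one_pow ⟨k + 1, rfl⟩]
    rw [h2, add_comm (Finset.sum _ _), sub_eq_add_neg, ← Finset.sum_neg_distrib]
    congr 1
    refine Finset.sum_congr rfl fun i _ => ?_
    rw [← Finsupp.single_neg]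
    congr 1
    ring

/-- A minimal `x` is the first vertex of every simplex containing it, so its link is the part of `S`
above it. -/
theorem AcyclicBelow.of_minimal {S : Set P} {x : P} (hx : x ∈ S) (hmin : ∀ y ∈ S, ¬ y < x) {m : ℕ}
    (h1 : AcyclicBelow (S \ {x}) (m + 1)) (h2 : AcyclicBelow (S ∩ Set.Ioi x) m) :
    AcyclicBelow S (m + 1) := by
  refine (consJoin x (S ∩ Set.Ioi x) fun y hy => hy.2).acyclicBelow hx
    (fun y hy => ⟨hy.1, hy.2.ne'⟩) (fun k c hc hcx => ?_) h1 h2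
  obtain ⟨i, hi⟩ := hcx
  have h0 : c 0 = x := by
    by_contra h
    exact hmin (c 0) (hc 0) (lt_of_le_of_ne (hi ▸ c.monotone (Fin.zero_le i)) h)
  refine ⟨(Fin.succOrderEmb k).trans c, fun i => ⟨hc _, ?_⟩, ?_⟩
  · rw [← h0]
    exact c.strictMono (Fin.succ_pos i)
  · ext i
    cases i using Fin.cases with
    | zero => exact h0.symm
    | succ i => rfl

theorem AcyclicBelow.of_maximal {S : Set P} {x : P} (hx : x ∈ S) (hmax : ∀ y ∈ S, ¬ x < y) {m : ℕ}
    (h1 : AcyclicBelow (S \ {x}) (m + 1)) (h2 : AcyclicBelow (S ∩ Set.Iio x) m) :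
    AcyclicBelow S (m + 1) := by
  refine (snocJoin x (S ∩ Set.Iio x) fun y hy => hy.2).acyclicBelow hx
    (fun y hy => ⟨hy.1, hy.2.ne⟩) (fun k c hc hcx => ?_) h1 h2
  obtain ⟨i, hi⟩ := hcx
  have h0 : c (Fin.last k) = x := by
    by_contra h
    exact hmax _ (hc (Fin.last k)) (lt_of_le_of_ne (hi ▸ c.monotone (Fin.le_last i)) (Ne.symm h))
  refine ⟨Fin.castSuccOrderEmb.trans c, fun i => ⟨hc _, ?_⟩, ?_⟩
  · rw [← h0]
    exact c.strictMono (Fin.castSucc_lt_last i)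
  · ext i
    cases i using Fin.lastCases with
    | last => simp [snocJoin, h0]
    | cast i => simp [snocJoin]

theorem acyclicBelow_singleton (a : P) (m : ℕ) : AcyclicBelow {a} m := by
  intro k _ z hz hcyc
  let J := consJoin a (∅ : Set P) (by simp)
  cases k with
  | zero =>
    have hz' := chainsIn_zero_le _ ∅ hz
    exact ⟨J.cone 0 z, J.cone_mem (Set.mem_singleton a) (Set.empty_subset _) hz',
      J.boundary_cone_zero hz'⟩
  | succ k =>
    suffices z = 0 from ⟨0, Submodule.zero_mem _, by simp [this]⟩
    cases k with
    | zero =>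
      let c0 : Fin 1 ↪o P := OrderEmbedding.ofStrictMono (fun _ => a) fun i j h => by
        rw [Subsingleton.elim i j] at h
        exact absurd h (lt_irrefl _)
      have hc : ∀ c, z c ≠ 0 → c = c0 := fun c hc => by
        ext i
        exact mem_chainsIn.1 hz c hc i
      have hz1 : z = z c0 • Finsupp.single c0 1 := by
        ext c
        by_cases h : c = c0
        · simp [h]
        · rw [not_imp_comm.1 (hc c) h]
          simp [Ne.symm h]
      have h0 : orderBoundary P 0 z = 0 := hcyc
      rw [hz1, map_smul, orderBoundary_single, Fin.sum_univ_one] at h0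
      have h2 : z c0 = 0 := by
        have := DFunLike.congr_fun h0 (face c0 0)
        simpa using this
      rw [hz1, h2, zero_smul]
    | succ k =>
      ext c
      by_contra h
      have hc := mem_chainsIn.1 hz c h
      have h01 : c 0 < c 1 := c.strictMono (by simp)
      rw [hc 0, hc 1] at h01
      exact lt_irrefl _ h01

end Acyclic

/-! ## Upper intervals of partition lattices -/

theorem AcyclicBelow.mono {P : Type} [PartialOrder P] {S : Set P} {m m' : ℕ}
    (h : AcyclicBelow S m) (hm : m' ≤ m) : AcyclicBelow S m' :=
  fun k hk => h k (hk.trans_le hm)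

theorem acyclicBelow_zero {P : Type} [PartialOrder P] (S : Set P) : AcyclicBelow S 0 :=
  fun k hk => absurd hk (Nat.not_lt_zero k)

/-- A set closed under meets with one of its elements is acyclic. -/
theorem acyclicBelow_of_inf_mem {P : Type} [SemilatticeInf P] [Finite P] {S : Set P} {a : P}
    (ha : a ∈ S) (hS : ∀ x ∈ S, x ⊓ a ∈ S) (m : ℕ) : AcyclicBelow S m := by
  induction hN : S.ncard using Nat.strong_induction_on generalizing S a m with
  | _ N ih =>
    subst hN
    cases m with
    | zero => exact acyclicBelow_zero S
    | succ m =>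
      -- Elements not below `a` are removed from the top. In the link of a maximal such `x`, the
      -- element `x ⊓ a` plays the role of `a`.
      by_cases h : ∃ x ∈ S, ¬ x ≤ a
      · obtain ⟨x, hx⟩ := (Set.toFinite {x | x ∈ S ∧ ¬ x ≤ a}).exists_maximal h
        obtain ⟨hxS, hxa⟩ := hx.prop
        have hlt : x ⊓ a < x := inf_lt_left.2 hxa
        have hcard : (S ∩ Set.Iio x).ncard < S.ncard :=
          Set.ncard_lt_ncard ⟨Set.inter_subset_left, fun hs => lt_irrefl x (hs hxS).2⟩
        refine AcyclicBelow.of_maximal hxS (fun y hy hxy => ?_)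
          (ih _ (Set.ncard_sdiff_singleton_lt_of_mem hxS) (S := S \ {x}) (a := a) ⟨ha, ?_⟩
            (fun y hy => ⟨hS y hy.1, ?_⟩)
            _ rfl)
          (ih _ hcard (S := S ∩ Set.Iio x) (a := x ⊓ a) ⟨hS x hxS, hlt⟩
            (fun y hy => ⟨?_, ?_⟩) _ rfl)
        · exact hx.not_prop_of_gt hxy ⟨hy, fun hya => hxa (hxy.le.trans hya)⟩
        · rintro rfl
          exact hxa le_rfl
        · rintro rfl
          exact hxa inf_le_right
        · have hyx : y ≤ x := (Set.mem_Iio.1 hy.2).le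
          rw [← inf_assoc, inf_eq_left.2 hyx]
          exact hS y hy.1
        · exact inf_le_right.trans_lt hlt
      · push Not at h
        -- Now `a` is the greatest element; minimal elements are removed until only `a` remains.
        by_cases h' : ∃ x ∈ S, x ≠ a
        · obtain ⟨x, hx⟩ := (Set.toFinite {x | x ∈ S ∧ x ≠ a}).exists_minimal h'
          obtain ⟨hxS, hxa⟩ := hx.prop
          refine AcyclicBelow.of_minimal hxS (fun y hy hyx => ?_)
            (ih _ (Set.ncard_sdiff_singleton_lt_of_mem hxS) (S := S \ {x}) (a := a) ⟨ha, hxa.symm⟩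
              (fun y hy => ?_) _ rfl)
            (ih _ (Set.ncard_lt_ncard ⟨Set.inter_subset_left, fun hs => lt_irrefl x (hs hxS).2⟩)
              (S := S ∩ Set.Ioi x) (a := a) ⟨ha, lt_of_le_of_ne (h x hxS) hxa⟩
                (fun y hy => ?_) _ rfl)
          · refine hx.not_prop_of_lt hyx ⟨hy, ?_⟩
            rintro rfl
            exact (h x hxS).not_gt hyx
          · rwa [inf_eq_left.2 (h y hy.1)]
          · rwa [inf_eq_left.2 (h y hy.1)]
        · push Not at h'
          rw [Set.eq_singleton_iff_unique_mem.2 ⟨ha, h'⟩]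
          exact acyclicBelow_singleton a _

/-- If the elements of an open interval whose meet with `a` is the lower end form an antichain, the
homology of the interval is controlled by the intervals above these elements. -/
theorem acyclicBelow_Ioo_of_antichain {P : Type} [SemilatticeInf P] [Finite P] {r t a : P}
    (ha : a ∈ Set.Ioo r t) {m : ℕ}
    (hY : ∀ y ∈ Set.Ioo r t, y ⊓ a = r → ∀ y' ∈ Set.Ioo r t, y' ⊓ a = r → ¬ y < y')
    (hm : ∀ y ∈ Set.Ioo r t, y ⊓ a = r → AcyclicBelow (Set.Ioo y t) m) :
    AcyclicBelow (Set.Ioo r t) (m + 1) := by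
  let Y : Set P := {y | y ∈ Set.Ioo r t ∧ y ⊓ a = r}
  -- Without `Y` the interval is closed under meets with `a`, hence acyclic. The elements of the
  -- antichain `Y` can be restored in any order.
  suffices h : ∀ T : Set P, T ⊆ Y → AcyclicBelow ((Set.Ioo r t \ Y) ∪ T) (m + 1) by
    have h1 := h Y subset_rfl
    rwa [Set.sdiff_union_of_subset fun y hy => hy.1] at h1
  intro T
  induction T, Set.toFinite T using Set.Finite.induction_on with
  | empty =>
    intro _
    rw [Set.union_empty]
    refine acyclicBelow_of_inf_mem (S := Set.Ioo r t \ Y) (a := a) ⟨ha, fun h => ha.1.ne' ?_⟩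
      (fun x hx => ⟨⟨?_, ?_⟩, ?_⟩) _
    · rw [← h.2, inf_idem]
    · exact lt_of_le_of_ne (le_inf hx.1.1.le ha.1.le) fun h => hx.2 ⟨hx.1, h.symm⟩
    · exact inf_le_right.trans_lt ha.2
    · intro h
      rw [Set.mem_ofPred_eq, inf_assoc, inf_idem] at h
      exact hx.2 ⟨hx.1, h.2⟩
  | @insert y T hyT _ ih =>
    intro hT
    have hy : y ∈ Y := hT (Set.mem_insert y T)
    have hTY : T ⊆ Y := (Set.subset_insert y T).trans hT
    have hsub : (Set.Ioo r t \ Y) ∪ insert y T ⊆ Set.Ioo r t :=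
      Set.union_subset Set.sdiff_subset (hT.trans fun z hz => hz.1)
    refine AcyclicBelow.of_minimal (x := y) (Or.inr (Set.mem_insert y T)) (fun z hz hzy => ?_) ?_ ?_
    · have hzS := hsub hz
      refine hY z hzS (le_antisymm ?_ (le_inf hzS.1.le ha.1.le)) y hy.1 hy.2 hzy
      rw [← hy.2]
      exact inf_le_inf_right a hzy.le
    · convert ih hTY using 1
      ext z
      by_cases hzy : z = y
      · subst hzy
        simp [hy, hyT]
      · simp [hzy]
    -- No element of `Y` lies above `y`, so the link is the whole interval above `y`.
    · convert hm y hy.1 hy.2 using 1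
      ext z
      refine ⟨fun hz => ⟨hz.2, (hsub hz.1).2⟩,
        fun hz => ⟨Or.inl ⟨⟨hy.1.1.trans hz.1, hz.2⟩, ?_⟩, hz.1⟩⟩
      exact fun hzY => hY y hy.1 hy.2 z hzY.1 hzY.2 hz.1

theorem card_quotient_lt_of_lt {α : Type} [Finite α] {r s : Setoid α} (h : r < s) :
    Nat.card (Quotient s) < Nat.card (Quotient r) := by
  let f : Quotient r → Quotient s := Quotient.map' id h.le
  have hf : Function.Surjective f := by
    rintro ⟨x⟩
    exact ⟨Quotient.mk r x, rfl⟩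
  refine lt_of_le_of_ne (Nat.card_le_card_of_surjective f hf) fun hc => h.not_ge fun x y hxy => ?_
  have hi : Function.Injective f := by
    have := Fintype.ofFinite (Quotient r)
    have := Fintype.ofFinite (Quotient s)
    refine ((Fintype.bijective_iff_surjective_and_card f).2 ⟨hf, ?_⟩).1
    rw [← Nat.card_eq_fintype_card, ← Nat.card_eq_fintype_card, hc]
  exact Quotient.exact (hi (a₁ := Quotient.mk r x) (a₂ := Quotient.mk r y) (Quotient.sound hxy))

instance Setoid.instFinite {α : Type*} [Finite α] : Finite (Setoid α) :=
  Finite.of_injective (fun r : Setoid α => (fun x y => r x y : α → α → Prop)) fun _ _ h =>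
    Setoid.ext fun x y => iff_of_eq (congrFun (congrFun h x) y)

/-- Induction on the number of blocks. With fewer than three blocks the truncated subtraction gives
`0` and nothing is claimed. -/
theorem acyclicBelow_partition {α : Type} [Finite α] (r : Setoid α) :
    AcyclicBelow (Set.Ioo r ⊤) (Nat.card (Quotient r) - 2) := by
  induction hN : Nat.card (Quotient r) using Nat.strong_induction_on generalizing r with
  | _ N ih =>
    subst hN
    rcases Nat.lt_or_ge (Nat.card (Quotient r)) 3 with h3 | h3
    · rw [Nat.sub_eq_zero_of_le (by omega)]
      exact acyclicBelow_zero _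
    obtain ⟨m, hm⟩ : ∃ m, Nat.card (Quotient r) = m + 3 := ⟨_, (Nat.sub_add_cancel h3).symm⟩
    have : Nonempty (Quotient r) := (Nat.card_pos_iff.1 (by omega)).1
    obtain ⟨q⟩ := this
    obtain ⟨b, rfl⟩ := Quotient.exists_rep q
    -- This partition has two blocks: the block of `b` and the union of all the others.
    let a : Setoid α := Setoid.ker fun x => r x b
    have hra : r ≤ a := fun x y hxy =>
      propext ⟨fun h => r.trans (r.symm hxy) h, fun h => r.trans hxy h⟩
    have haX : ∀ x y, ¬ r x b → ¬ r y b → a x y := fun x y hx hy =>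
      propext ⟨fun h => absurd h hx, fun h => absurd h hy⟩
    -- If `y ⊓ a = r`, then `y` merges no two blocks other than that of `b`, so it loses at most one
    -- block. Proper complements thus lose exactly one, which makes them an antichain.
    have hcard : ∀ y : Setoid α, y ⊓ a = r → Nat.card (Quotient r) ≤ Nat.card (Quotient y) + 1 := by
      intro y hy
      let f : {q : Quotient r // q ≠ Quotient.mk r b} → Quotient y := fun q =>
        Quotient.map' id (hy ▸ inf_le_left : r ≤ y) q.1
      have hf : Function.Injective f := by
        rintro ⟨⟨u⟩, hu⟩ ⟨⟨v⟩, hv⟩ huv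
        have huv' : y u v := Quotient.exact huv
        have hu' : ¬ r u b := fun h => hu (Quotient.sound h)
        have hv' : ¬ r v b := fun h => hv (Quotient.sound h)
        have : r u v := by
          rw [← hy]
          exact ⟨huv', haX u v hu' hv'⟩
        exact Subtype.ext (Quotient.sound this)
      have h1 := Nat.card_le_card_of_injective f hf
      have h2 : Nat.card {q : Quotient r // q ≠ Quotient.mk r b} = Nat.card (Quotient r) - 1 := by
        classical
        have := Fintype.ofFinite (Quotient r)
        rw [Nat.card_eq_fintype_card, Nat.card_eq_fintype_card]
        exact Set.card_ne_eq (Quotient.mk r b)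
      omega
    have hlt : ∀ y ∈ Set.Ioo r ⊤, Nat.card (Quotient y) < Nat.card (Quotient r) :=
      fun y hy => card_quotient_lt_of_lt hy.1
    have haI : a ∈ Set.Ioo r ⊤ := by
      refine ⟨lt_of_le_of_ne hra fun h => ?_, lt_top_iff_ne_top.2 fun h => ?_⟩
      · have h2 : Nat.card (Quotient a) ≤ 2 := by
          have h4 := Nat.card_le_card_of_injective _ (Setoid.kerLift_injective fun x => r x b)
          rwa [Nat.card_eq_fintype_card (α := Prop), Fintype.card_prop] at h4
        rw [← h] at h2
        omega
      · have h2 : ∀ x, r x b := fun x => by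
          have h4 : a x b := by
            rw [h]
            trivial
          have h5 : r x b = r b b := h4
          rw [h5]
        have h4 : Nat.card (Quotient r) ≤ 1 := by
          rw [Finite.card_le_one_iff_subsingleton]
          refine ⟨?_⟩
          rintro ⟨x⟩ ⟨y⟩
          exact Quotient.sound (r.trans (h2 x) (r.symm (h2 y)))
        omega
    rw [hm, show m + 3 - 2 = m + 1 by omega]
    refine acyclicBelow_Ioo_of_antichain haI (fun y hy hya y' hy' hya' hyy' => ?_)
      fun y hy hya => ?_
    · have h4 := card_quotient_lt_of_lt hyy'
      have h5 := hlt y hy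
      have h6 := hcard y' hya'
      omega
    · have h4 := hcard y hya
      exact (ih _ (hlt y hy) y rfl).mono (by omega)

theorem length_le_of_properPart_chain {n k : ℕ} (c : Fin k ↪o ProperPart (PartitionLattice n)) :
    k ≤ n - 2 := by
  have hbot : Nat.card (Quotient (⊥ : Setoid (Fin n))) = n := by
    rw [← Nat.card_congr (Equiv.ofBijective (Quotient.mk (⊥ : Setoid (Fin n)))
      ⟨fun x y h => Quotient.exact h, Quotient.mk_surjective⟩), Nat.card_fin]
  have htop : 1 ≤ Nat.card (Quotient (⊤ : Setoid (Fin n))) ∨ k = 0 := by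
    rcases Nat.eq_zero_or_pos k with hk | hk
    · exact Or.inr hk
    · refine Or.inl (Nat.card_pos_iff.2 ⟨?_, inferInstance⟩)
      rcases n.eq_zero_or_pos with rfl | hn
      · exact absurd (Setoid.ext fun x => x.elim0) (c ⟨0, hk⟩).2.1
      · exact ⟨Quotient.mk _ ⟨0, hn⟩⟩
  -- Block numbers strictly decrease along a chain and lie between `2` and `n - 1`.
  let f : Fin k → Finset.Ico 2 n := fun i => ⟨Nat.card (Quotient (c i).1), by
    have h1 := card_quotient_lt_of_lt (bot_lt_iff_ne_bot.2 (c i).2.1)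
    have h2 := card_quotient_lt_of_lt (lt_top_iff_ne_top.2 (c i).2.2)
    have h3 := i.2
    rw [Finset.mem_Ico]
    omega⟩
  have hf : Function.Injective f := by
    intro i j hij
    have hij' : Nat.card (Quotient (c i).1) = Nat.card (Quotient (c j).1) :=
      congrArg Subtype.val hij
    rcases lt_trichotomy i j with h | h | h
    · exact absurd (card_quotient_lt_of_lt (Subtype.coe_lt_coe.2 (c.strictMono h))) (by omega)
    · exact h
    · exact absurd (card_quotient_lt_of_lt (Subtype.coe_lt_coe.2 (c.strictMono h))) (by omega)
  simpa using Fintype.card_le_of_injective f hf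

/-! ## The character of the top homology -/

section Transfer

variable {Q P : Type} [PartialOrder Q] [PartialOrder P]

/-- The map on chains induced by an order embedding. -/
noncomputable def mapChains (e : Q ↪o P) (k : ℕ) : OrderChains Q k →ₗ[ℂ] OrderChains P k :=
  Finsupp.lmapDomain ℂ ℂ fun c => c.trans e

theorem mapChains_injective (e : Q ↪o P) (k : ℕ) : Function.Injective (mapChains e k) := by
  refine Finsupp.mapDomain_injective fun c c' h => ?_
  ext i
  exact e.injective (DFunLike.congr_fun h i)

theorem orderBoundary_mapChains (e : Q ↪o P) (k : ℕ) (z : OrderChains Q (k + 1)) :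
    orderBoundary P k (mapChains e (k + 1) z) = mapChains e k (orderBoundary Q k z) := by
  have h : orderBoundary P k ∘ₗ mapChains e (k + 1) = mapChains e k ∘ₗ orderBoundary Q k := by
    ext c : 2
    simp only [mapChains, LinearMap.comp_apply, Finsupp.lsingle_apply, Finsupp.lmapDomain_apply,
      Finsupp.mapDomain_single, orderBoundary_single, Finsupp.mapDomain_finsetSum]
    rfl
  exact LinearMap.congr_fun h z

theorem map_mapChains_top (e : Q ↪o P) (k : ℕ) :
    Submodule.map (mapChains e k) ⊤ = chainsIn (Set.range e) k := by
  rw [← Finsupp.supported_univ, mapChains, Finsupp.lmapDomain_supported, chainsIn]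
  congr 1
  ext c
  simp only [Set.image_univ, Set.mem_range, Set.mem_ofPred_eq]
  refine ⟨?_, fun h => ?_⟩
  · rintro ⟨d, rfl⟩ i
    exact ⟨d i, rfl⟩
  · choose d hd using h
    refine ⟨OrderEmbedding.ofMapLEIff d fun i j => ?_, ?_⟩
    · rw [← e.le_iff_le, hd, hd, c.le_iff_le]
    · ext i
      exact hd i

/-- The inductions vary a subset of a fixed poset; this transfers their result to the order complex
of the subset as a poset. -/
theorem AcyclicBelow.orderCycles_le (e : Q ↪o P) {m : ℕ} (h : AcyclicBelow (Set.range e) m)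
    {k : ℕ} (hk : k < m) : orderCycles Q k ≤ orderBoundaries Q k := by
  intro z hz
  have hz' : mapChains e k z ∈ chainsIn (Set.range e) k := by
    rw [← map_mapChains_top]
    exact Submodule.mem_map_of_mem Submodule.mem_top
  obtain ⟨w, hw, hwz⟩ := h k hk _ hz' (by
    cases k with
    | zero => exact Submodule.mem_top
    | succ k =>
      have h0 : orderBoundary Q k z = 0 := hz
      change orderBoundary P k _ = 0
      rw [orderBoundary_mapChains, h0, map_zero])
  rw [← map_mapChains_top] at hw
  obtain ⟨w', -, rfl⟩ := hw
  refine ⟨w', mapChains_injective e k ?_⟩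
  rw [← orderBoundary_mapChains, hwz]

end Transfer

theorem LinearMap.trace_restrict_congr {V : Type*} [AddCommGroup V] [Module ℂ V]
    {p q : Submodule ℂ V} (h : p = q) (a : V →ₗ[ℂ] V) (hp : ∀ x ∈ p, a x ∈ p)
    (hq : ∀ x ∈ q, a x ∈ q) :
    LinearMap.trace ℂ p (a.restrict hp) = LinearMap.trace ℂ q (a.restrict hq) := by
  subst h
  rfl

theorem character_subquotientRep_of_eq_bot {G V : Type} [Group G] [AddCommGroup V] [Module ℂ V]
    [FiniteDimensional ℂ V] {ρ : Representation ℂ G V} {Z B : Submodule ℂ V}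
    (hZ : ∀ g, Z ≤ Z.comap (ρ g)) (hB : ∀ g, B ≤ B.comap (ρ g)) (h : B = ⊥) (g : G) :
    (subquotientRep ρ Z B hZ hB).character g = LinearMap.trace ℂ Z ((ρ g).restrict (hZ g)) := by
  let N := B.submoduleOf Z
  have hN : N = ⊥ := by
    simp [N, h, Submodule.submoduleOf]
  have h1 := LinearMap.trace_eq_trace_restrict_ker_add N.mkQ N.mkQ_surjective
    ((ρ g).restrict (hZ g)) (subquotientRep ρ Z B hZ hB g) rfl (fun x hx => by
      rw [Submodule.ker_mkQ, hN, Submodule.mem_bot] at hx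
      rw [hx, map_zero]
      exact Submodule.zero_mem _)
  have h2 : Subsingleton (LinearMap.ker N.mkQ) := by
    rw [Submodule.ker_mkQ, hN]
    infer_instance
  rw [h1, Subsingleton.elim (LinearMap.restrict _ _) 0, map_zero, zero_add]
  rfl

/-! ### The Hopf trace formula. -/

section HopfTrace

variable {G : Type} [Group G] {Q : Type} [PartialOrder Q] [Finite Q] (α : G →* (Q ≃o Q)) (g : G)

instance OrderEmbedding.instFinite (k : ℕ) : Finite (Fin k ↪o Q) :=
  Finite.of_injective (fun c : Fin k ↪o Q => (c : Fin k → Q)) DFunLike.coe_injective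

theorem trace_orderChainsRep (k : ℕ) : LinearMap.trace ℂ _ (orderChainsRep α k g) =
    Nat.card {c : Fin k ↪o Q // c.trans (α g).toOrderEmbedding = c} :=
  LinearMap.trace_finsupp_lmapDomain _

theorem trace_restrict_orderCycles {K : ℕ} (hK : ∀ k < K, orderCycles Q k ≤ orderBoundaries Q k) :
    LinearMap.trace ℂ _ ((orderChainsRep α K g).restrict (orderCycles_invariant α K g)) =
      ∑ k ∈ Finset.range (K + 1), (-1) ^ (K + k) *
        (Nat.card {c : Fin k ↪o Q // c.trans (α g).toOrderEmbedding = c} : ℂ) := by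
  induction K with
  | zero =>
    rw [Finset.sum_range_one, ← trace_orderChainsRep]
    have h := LinearMap.trace_conj' (R := ℂ) (M := orderCycles Q 0)
      (N := OrderChains Q 0) ((orderChainsRep α 0 g).restrict (orderCycles_invariant α 0 g))
      (LinearEquiv.ofTop (orderCycles Q 0) rfl)
    rw [← h, pow_zero, one_mul]
    congr 1
  | succ K ih =>
    have ih' := ih fun k hk => hK k (by omega)
    have hbd : ∀ z, orderBoundary Q K z ∈ orderCycles Q K := by
      intro z
      cases K with
      | zero => exact Submodule.mem_top
      | succ K => exact orderBoundary_orderBoundary_apply K z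
    -- Vanishing homology makes the boundary map onto the cycles surjective; its kernel is the next
    -- space of cycles, so traces add.
    let f : OrderChains Q (K + 1) →ₗ[ℂ] orderCycles Q K :=
      LinearMap.codRestrict _ (orderBoundary Q K) hbd
    have hf : Function.Surjective f := by
      rintro ⟨z, hz⟩
      obtain ⟨w, hw⟩ := hK K (by omega) hz
      exact ⟨w, Subtype.ext hw⟩
    have hker : LinearMap.ker f = orderCycles Q (K + 1) := LinearMap.ker_codRestrict _ _ _
    have h1 := LinearMap.trace_eq_trace_restrict_ker_add (V := OrderChains Q (K + 1))
      (W := orderCycles Q K) f hf (orderChainsRep α (K + 1) g)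
      ((orderChainsRep α K g).restrict (orderCycles_invariant α K g)) (by
        refine LinearMap.ext fun z => ?_
        exact Subtype.ext (orderBoundary_orderChainsRep α K g z)) (by
        rw [hker]
        exact orderCycles_invariant α (K + 1) g)
    rw [ih', trace_orderChainsRep, LinearMap.trace_restrict_congr hker _ _
      (orderCycles_invariant α (K + 1) g)] at h1
    rw [eq_sub_of_add_eq h1.symm, Finset.sum_range_succ _ (K + 1), ← two_mul, pow_mul]
    simp only [pow_add, pow_one, neg_sq, one_pow, one_mul]
    rw [sub_eq_neg_add, ← Finset.sum_neg_distrib]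
    congr 1
    refine Finset.sum_congr rfl fun k _ => ?_
    ring

/-- The Hopf trace formula for a complex with homology only in the top degree. -/
theorem character_orderHomology {K : ℕ} (hK : ∀ k < K, orderCycles Q k ≤ orderBoundaries Q k)
    (hK' : IsEmpty (Fin (K + 1) ↪o Q)) :
    (orderHomology α K).ρ.character g =
      ∑ k ∈ Finset.range (K + 1), (-1) ^ (K + k) *
        (Nat.card {c : Fin k ↪o Q // c.trans (α g).toOrderEmbedding = c} : ℂ) := by
  rw [← trace_restrict_orderCycles α g hK]
  refine character_subquotientRep_of_eq_bot (orderCycles_invariant α K)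
    (orderBoundaries_invariant α K) ?_ g
  rw [orderBoundaries, LinearMap.range_eq_bot]
  exact LinearMap.ext fun z => by rw [Subsingleton.elim z 0, map_zero, map_zero]

end HopfTrace

theorem isEmpty_properPart_chain {n : ℕ} :
    IsEmpty (Fin (n - 2 + 1) ↪o ProperPart (PartitionLattice n)) :=
  ⟨fun c => absurd (length_le_of_properPart_chain c) (by omega)⟩

theorem orderCycles_properPart_le {n k : ℕ} (hk : k < n - 2) :
    orderCycles (ProperPart (PartitionLattice n)) k ≤
      orderBoundaries (ProperPart (PartitionLattice n)) k := by
  refine AcyclicBelow.orderCycles_le (m := n - 2) (OrderEmbedding.subtype _) ?_ hk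
  have h := acyclicBelow_partition (⊥ : Setoid (Fin n))
  have h1 : Nat.card (Quotient (⊥ : Setoid (Fin n))) = n := by
    rw [← Nat.card_congr (Equiv.ofBijective (Quotient.mk (⊥ : Setoid (Fin n)))
      ⟨fun x y h => Quotient.exact h, Quotient.mk_surjective⟩), Nat.card_fin]
  rw [h1] at h
  convert h using 1
  ext x
  simp [bot_lt_iff_ne_bot, lt_top_iff_ne_top]

/-! ## Euler characteristics of lower intervals -/

section Mobius

variable {F : Type} [PartialOrder F] [OrderBot F]

/-- The number of chains of `k` elements in the open interval from `⊥` to `t`. -/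
noncomputable def chainCount (k : ℕ) (t : F) : ℕ :=
  Nat.card {c : Fin k ↪o F // ∀ i, c i ∈ Set.Ioo ⊥ t}

theorem chainCount_zero (t : F) : chainCount 0 t = 1 := by
  rw [chainCount, Nat.card_eq_one_iff_unique]
  refine ⟨⟨fun c c' => Subtype.ext (by ext i; exact i.elim0)⟩,
    ⟨⟨OrderEmbedding.ofIsEmpty, fun i => i.elim0⟩⟩⟩

theorem chainCount_eq_zero [Finite F] {k : ℕ} (hk : Nat.card F < k) (t : F) :
    chainCount k t = 0 := by
  rw [chainCount, Nat.card_eq_zero]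
  refine Or.inl ⟨fun c => hk.not_ge ?_⟩
  simpa using Nat.card_le_card_of_injective _ c.1.injective

open Classical in
-- Chains are sorted by their greatest element.
theorem chainCount_succ [Fintype F] (k : ℕ) (t : F) :
    chainCount (k + 1) t = ∑ s : F with s ∈ Set.Ioo ⊥ t, chainCount k s := by
  rw [chainCount, ← Nat.card_congr (Equiv.sigmaFiberEquiv
    fun c : {c : Fin (k + 1) ↪o F // ∀ i, c i ∈ Set.Ioo ⊥ t} => c.1 (Fin.last k)), Nat.card_sigma,
    Finset.sum_filter]
  refine Finset.sum_congr rfl fun s _ => ?_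
  split_ifs with hs
  · refine Nat.card_congr
      { toFun := fun c => ⟨Fin.castSuccOrderEmb.trans c.1.1, fun i => ⟨(c.1.2 _).1, ?_⟩⟩
        invFun := fun c => ⟨⟨snocChain s k c.1 fun i => (c.2 i).2, fun i => ?_⟩, ?_⟩
        left_inv := fun c => ?_
        right_inv := fun c => ?_ }
    · exact lt_of_lt_of_eq (c.1.1.strictMono (Fin.castSucc_lt_last i)) c.2
    · cases i using Fin.lastCases with
      | last => simpa using hs
      | cast i => simpa using ⟨(c.2 i).1, (c.2 i).2.trans hs.2⟩
    · exact snocChain_last s k c.1 fun i => (c.2 i).2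
    · refine Subtype.ext (Subtype.ext ?_)
      ext i
      cases i using Fin.lastCases with
      | last => simpa using c.2.symm
      | cast i => simp
    · refine Subtype.ext ?_
      ext i
      simp
  · rw [Nat.card_eq_zero]
    exact Or.inl ⟨fun c => hs (c.2 ▸ c.1.2 _)⟩

open Classical in
/-- The reduced Euler characteristic of the open interval from `⊥` to `t`, and `1` if `t = ⊥`. -/
noncomputable def mobius (t : F) : ℤ :=
  if t = ⊥ then 1 else ∑ k ∈ Finset.range (Nat.card F + 2), (-1) ^ (k + 1) * (chainCount k t : ℤ)

theorem mobius_bot : mobius (⊥ : F) = 1 := if_pos rfl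

open Classical in
-- The range in `mobius` has one spare term: it is dropped for `s`, while for `t` the term of the
-- empty chain is split off, giving `-1`.
theorem mobius_of_ne_bot [Fintype F] {t : F} (ht : t ≠ ⊥) :
    mobius t = -1 - ∑ s : F with s ∈ Set.Ioo ⊥ t, mobius s := by
  have h1 : ∀ s ∈ Finset.univ.filter fun s : F => s ∈ Set.Ioo ⊥ t, mobius s =
      ∑ k ∈ Finset.range (Nat.card F + 1), (-1) ^ (k + 1) * (chainCount k s : ℤ) := by
    intro s hs
    have hs' := (Finset.mem_filter.1 hs).2
    rw [mobius, if_neg hs'.1.ne', Finset.sum_range_succ, chainCount_eq_zero (Nat.lt_succ_self _)]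
    simp
  rw [Finset.sum_congr rfl h1, mobius, if_neg ht, Finset.sum_range_succ', chainCount_zero,
    Finset.sum_comm, add_comm, sub_eq_add_neg, ← Finset.sum_neg_distrib]
  congr 1
  refine Finset.sum_congr rfl fun k _ => ?_
  rw [chainCount_succ, ← Finset.mul_sum, Nat.cast_sum]
  ring

open Classical in
theorem sum_mobius_le [Fintype F] (t : F) :
    ∑ s : F with s ≤ t, mobius s = if t = ⊥ then 1 else 0 := by
  split_ifs with ht
  · subst ht
    have : (Finset.univ.filter fun s : F => s ≤ ⊥) = {⊥} := by
      ext s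
      simp
    rw [this, Finset.sum_singleton, mobius_bot]
  · have : (Finset.univ.filter fun s : F => s ≤ t) =
        insert ⊥ (insert t (Finset.univ.filter fun s : F => s ∈ Set.Ioo ⊥ t)) := by
      ext s
      simp only [Finset.mem_filter, Finset.mem_univ, true_and, Finset.mem_insert, Set.mem_Ioo,
        bot_lt_iff_ne_bot]
      refine ⟨fun h => ?_, ?_⟩
      · by_cases h1 : s = ⊥
        · exact Or.inl h1
        · by_cases h2 : s = t
          · exact Or.inr (Or.inl h2)
          · exact Or.inr (Or.inr ⟨h1, lt_of_le_of_ne h h2⟩)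
      · rintro (rfl | rfl | h)
        · exact bot_le
        · exact le_rfl
        · exact h.2.le
    rw [this, Finset.sum_insert (by simp [Ne.symm ht]), Finset.sum_insert (by simp), mobius_bot,
      mobius_of_ne_bot ht]
    ring

/-- The Euler characteristic can be computed with any range covering all chain lengths. -/
theorem mobius_eq_sum [Finite F] {t : F} (ht : t ≠ ⊥) {N : ℕ}
    (hN : ∀ k, N ≤ k → chainCount k t = 0) :
    mobius t = ∑ k ∈ Finset.range N, (-1) ^ (k + 1) * (chainCount k t : ℤ) := by
  rw [mobius, if_neg ht]
  rcases le_total N (Nat.card F + 2) with h | h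
  · refine (Finset.sum_subset (Finset.range_mono h) fun k _ hk => ?_).symm
    rw [hN k (by simpa using hk)]
    simp
  · refine Finset.sum_subset (Finset.range_mono h) fun k _ hk => ?_
    rw [chainCount_eq_zero (by simp at hk; omega)]
    simp

end Mobius

/-! ## Counting equivariant colourings -/

open Polynomial in
-- Both sides are polynomials in `q` agreeing at all naturals, so their coefficients of `q` agree.
-- That of the falling factorial at `m * q` is `m * (-1)^(m-1) * (m-1)!`.
theorem sum_filter_eq_one_of_sum_pow_eq_descFactorial {ι : Type*} [Fintype ι] (v : ι → ℤ)
    (e : ι → ℕ) (K m : ℕ) (hm : m ≠ 0)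
    (h : ∀ q : ℕ, ∑ i, v i * (q : ℤ) ^ e i = K * ((m * q).descFactorial m : ℕ)) :
    ∑ i with e i = 1, v i = (-1) ^ (m + 1) * (K * m.factorial) := by
  obtain ⟨k, rfl⟩ := Nat.exists_eq_succ_of_ne_zero hm
  have hpoly : (∑ i, C (v i) * X ^ e i : ℤ[X]) =
      C (K : ℤ) * (descPochhammer ℤ (k + 1)).comp (C ((k + 1 : ℕ) : ℤ) * X) := by
    refine eq_of_infinite_eval_eq _ _
      ((Set.infinite_range_of_injective (Nat.cast_injective (R := ℤ))).mono ?_)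
    rintro _ ⟨q, rfl⟩
    simp only [Set.mem_ofPred_eq, eval_finsetSum, eval_mul, eval_C, eval_pow, eval_X, eval_comp]
    rw [h q, ← Nat.cast_mul (k + 1), descPochhammer_eval_eq_descFactorial]
  have hdesc : (descPochhammer ℤ k).eval (-1) = (-1) ^ k * k.factorial := by
    have h1 := ascPochhammer_eval_neg_eq_descPochhammer ℤ (-1) k
    rw [neg_neg, ascPochhammer_eval_one] at h1
    rw [h1, ← mul_assoc, ← mul_pow]
    simp
  have hc := congrArg (fun p : ℤ[X] => p.coeff 1) hpoly
  simp only [finsetSum_coeff, coeff_C_mul, coeff_X_pow, descPochhammer_succ_left, mul_comp,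
    X_comp, mul_assoc] at hc
  rw [show 1 = 0 + 1 from rfl, coeff_X_mul, coeff_zero_eq_eval_zero, eval_comp, eval_comp] at hc
  simp only [mul_ite, mul_one, mul_zero, eq_comm (a := 1)] at hc
  rw [Finset.sum_filter, hc]
  simp [hdesc, Nat.factorial_succ]
  ring

section Colourings

variable {α : Type} (g : Equiv.Perm α)

/-- The set partitions invariant under a permutation. -/
abbrev InvariantSetoid : Type := {r : Setoid α // ∀ x y, r (g x) (g y) ↔ r x y}

instance : OrderBot (InvariantSetoid g) where
  bot := ⟨⊥, fun _ _ => g.injective.eq_iff⟩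
  bot_le r := (bot_le : ⊥ ≤ r.1)

/-- The finest partition coarser than `r` and than the partition into orbits of `g`. -/
def orbitJoin (r : Setoid α) : Setoid α := Relation.EqvGen.setoid fun x y => r x y ∨ g x = y

theorem orbitJoin_le_iff {r s : Setoid α} : orbitJoin g r ≤ s ↔ r ≤ s ∧ ∀ x, s x (g x) := by
  refine ⟨fun h => ⟨fun x y hxy => h (Relation.EqvGen.rel _ _ (Or.inl hxy)),
    fun x => h (Relation.EqvGen.rel _ _ (Or.inr rfl))⟩, fun h => Setoid.eqvGen_le ?_⟩
  rintro x y (hxy | rfl)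
  · exact h.1 hxy
  · exact h.2 x

variable {A : Type} [AddCommGroup A] (j : A)

/-- The maps to `A` that intertwine `g` with the translation by `j` and are constant on the blocks
of `r`. -/
abbrev LabelOn (r : Setoid α) : Type :=
  {a : α → A // (∀ x, a (g x) = a x + j) ∧ r ≤ Setoid.ker a}

/-- The maps to `q` copies of `A` that intertwine `g` with the translation by `j`. -/
abbrev Colouring (q : ℕ) : Type :=
  {f : α → A × Fin q // ∀ x, f (g x) = ((f x).1 + j, (f x).2)}

variable [Finite α]

/-- The component in `A` is a labelling; the other is `g`-invariant, so it is a free choice of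
colour for each `g`-orbit on the blocks of `r`. -/
theorem card_colouring_constant_on (r : Setoid α) (q : ℕ) :
    Nat.card {f : Colouring g j q // r ≤ Setoid.ker f.1} =
      Nat.card (LabelOn g j r) * q ^ Nat.card (Quotient (orbitJoin g r)) := by
  have := Fintype.ofFinite (Quotient (orbitJoin g r))
  have h1 : Nat.card {h : α → Fin q // orbitJoin g r ≤ Setoid.ker h} =
      q ^ Nat.card (Quotient (orbitJoin g r)) := by
    rw [Nat.card_congr (Setoid.liftEquiv _), Nat.card_fun, Nat.card_fin]
  rw [← h1, ← Nat.card_prod]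
  refine Nat.card_congr
    { toFun := fun f => (⟨fun x => (f.1.1 x).1, fun x => ?_, fun x y hxy => ?_⟩,
        ⟨fun x => (f.1.1 x).2, (orbitJoin_le_iff g).2 ⟨fun x y hxy => ?_, fun x => ?_⟩⟩)
      invFun := fun p => ⟨⟨fun x => (p.1.1 x, p.2.1 x), fun x => ?_⟩, fun x y hxy => ?_⟩
      left_inv := fun f => rfl
      right_inv := fun p => rfl }
  · exact congrArg Prod.fst (f.1.2 x)
  · exact congrArg Prod.fst (f.2 hxy)
  · exact congrArg Prod.snd (f.2 hxy)
  · change (f.1.1 x).2 = (f.1.1 (g x)).2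
    rw [f.1.2]
  · exact Prod.ext (p.1.2.1 x) (((orbitJoin_le_iff g).1 p.2.2).2 x).symm
  · exact Prod.ext (p.1.2.2 hxy) (((orbitJoin_le_iff g).1 p.2.2).1 hxy)

open Classical in
-- Möbius inversion: the kernel of a colouring is an invariant partition, and summing `mobius r`
-- over `r` below it detects injectivity.
theorem sum_mobius_mul_card_label [Finite A] [Fintype (InvariantSetoid g)] (q : ℕ) :
    ∑ r : InvariantSetoid g, mobius r * Nat.card (LabelOn g j r.1) *
      (q : ℤ) ^ Nat.card (Quotient (orbitJoin g r.1)) =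
      Nat.card {f : Colouring g j q // Function.Injective f.1} := by
  have := Fintype.ofFinite (Colouring g j q)
  have hker : ∀ f : Colouring g j q, ∀ x y,
      Setoid.ker f.1 (g x) (g y) ↔ Setoid.ker f.1 x y := by
    intro f x y
    simp only [Setoid.ker_def, f.2, Prod.ext_iff, add_left_inj]
  have h1 : ∀ r : InvariantSetoid g, mobius r * Nat.card (LabelOn g j r.1) *
      (q : ℤ) ^ Nat.card (Quotient (orbitJoin g r.1)) =
      ∑ f : Colouring g j q, if r ≤ ⟨Setoid.ker f.1, hker f⟩ then mobius r else 0 := by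
    intro r
    rw [mul_assoc, ← Nat.cast_pow, ← Nat.cast_mul, ← card_colouring_constant_on,
      ← Finset.sum_filter, Finset.sum_const, Nat.card_eq_fintype_card, Fintype.card_subtype,
      nsmul_eq_mul, mul_comm]
    rfl
  rw [Finset.sum_congr rfl fun r _ => h1 r, Finset.sum_comm]
  simp only [← Finset.sum_filter, sum_mobius_le]
  rw [Nat.card_eq_fintype_card, Fintype.card_subtype, Finset.card_filter, Nat.cast_sum]
  refine Finset.sum_congr rfl fun f _ => ?_
  have h2 : (⟨Setoid.ker f.1, hker f⟩ : InvariantSetoid g) = ⊥ ↔ Function.Injective f.1 := by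
    rw [← Setoid.ker_eq_bot_iff]
    exact Subtype.ext_iff
  by_cases h3 : Function.Injective f.1
  · rw [if_pos (h2.2 h3), if_pos h3, Nat.cast_one]
  · rw [if_neg (h2.not.2 h3), if_neg h3, Nat.cast_zero]

end Colourings

/-! ### Counting injective colourings. -/

section Free

variable {α : Type} (g : Equiv.Perm α) {A : Type} [AddCommGroup A] (j : A)

theorem label_zpow {g : Equiv.Perm α} {j : A} {a : α → A} (ha : ∀ x, a (g x) = a x + j) (i : ℤ)
    (x : α) : a ((g ^ i) x) = a x + i • j := by
  induction i with
  | zero => simp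
  | succ i ih =>
    rw [add_comm, zpow_add, zpow_one, Equiv.Perm.mul_apply, ha, ih, add_comm 1, add_zsmul,
      one_zsmul,
      add_assoc]
  | pred i ih =>
    rw [← add_left_inj j, ← ha, ← Equiv.Perm.mul_apply, ← zpow_one_add, add_sub_cancel, ih,
      sub_zsmul,
      one_zsmul]
    abel

theorem apply_eq_of_sameCycle {β : Type*} {g : Equiv.Perm α} {h : α → β} (hg : ∀ x, h (g x) = h x)
    {x y : α} (hxy : g.SameCycle x y) : h x = h y := by
  obtain ⟨i, rfl⟩ := hxy
  induction i with
  | zero => rfl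
  | succ i ih => rw [ih, add_comm, zpow_add, zpow_one, Equiv.Perm.mul_apply, hg]
  | pred i ih =>
    rw [ih, ← hg ((g ^ (-(i : ℤ) - 1)) x), ← Equiv.Perm.mul_apply, ← zpow_one_add, add_sub_cancel]

/-- If the stabilizers of `g` annihilate `j`, then some map to `A` intertwines `g` with the
translation by `j`. -/
theorem exists_label (h : ∀ x (i : ℤ), (g ^ i) x = x → i • j = 0) :
    ∃ a : α → A, (∀ x, a (g x) = a x + j) ∧ ∀ x, a x ∈ AddSubgroup.zmultiples j := by
  let s : α → α := fun x => (Quotient.mk (Equiv.Perm.SameCycle.setoid g) x).out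
  have hs : ∀ x, ∃ i : ℤ, (g ^ i) (s x) = x := fun x =>
    Quotient.exact (Quotient.out_eq (Quotient.mk (Equiv.Perm.SameCycle.setoid g) x))
  have hsg : ∀ x, s (g x) = s x := fun x => by
    have : Quotient.mk (Equiv.Perm.SameCycle.setoid g) (g x) = Quotient.mk _ x :=
      Quotient.sound (Equiv.Perm.sameCycle_apply_left.2 (Equiv.Perm.SameCycle.refl g x))
    simp only [s, this]
  choose i hi using hs
  refine ⟨fun x => i x • j, fun x => ?_, fun x => AddSubgroup.zsmul_mem_zmultiples j (i x)⟩
  -- Two ways of reaching `g x` from the representative differ by a stabilizing power, which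
  -- annihilates `j`.
  have h1 : (g ^ (i (g x) - (1 + i x))) (s x) = s x := by
    have h2 := hi (g x)
    rw [hsg] at h2
    rw [sub_eq_neg_add, zpow_add, Equiv.Perm.mul_apply, h2, zpow_neg, Equiv.Perm.inv_eq_iff_eq,
      zpow_add, Equiv.Perm.mul_apply, hi, zpow_one]
  have h2 := h _ _ h1
  rw [sub_zsmul, add_zsmul, one_zsmul, ← sub_eq_add_neg, sub_eq_zero] at h2
  change i (g x) • j = i x • j + j
  rw [h2, add_comm]

variable {g j}

/-- An injective intertwiner preserves stabilizers, and translation by `i • j` fixes a point only if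
`i • j = 0`. -/
theorem zpow_apply_eq_self_iff_of_colouring {q : ℕ} (f : Colouring g j q)
    (hf : Function.Injective f.1) (x : α) (i : ℤ) : (g ^ i) x = x ↔ i • j = 0 := by
  have h1 : (f.1 ((g ^ i) x)).1 = (f.1 x).1 + i • j :=
    label_zpow (a := fun x => (f.1 x).1) (fun x => congrArg Prod.fst (f.2 x)) i x
  have h2 : (f.1 ((g ^ i) x)).2 = (f.1 x).2 := by
    exact (apply_eq_of_sameCycle (h := fun x => (f.1 x).2)
      (fun x => (Prod.ext_iff.1 (f.2 x)).2) ⟨i, rfl⟩).symm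
  rw [← hf.eq_iff, Prod.ext_iff, h1, h2]
  simp

/-- Splitting off the subgroup generated by `j`. -/
noncomputable def quotientProdEquiv (j : A) (q : ℕ) :
    A × Fin q ≃ ((A ⧸ AddSubgroup.zmultiples j) × Fin q) × AddSubgroup.zmultiples j where
  toFun p := ((p.1, p.2), ⟨-(p.1 : A ⧸ AddSubgroup.zmultiples j).out + p.1,
    QuotientAddGroup.eq.1 (Quotient.out_eq' _)⟩)
  invFun p := (p.1.1.out + p.2.1, p.1.2)
  left_inv p := by simp
  right_inv p := by
    obtain ⟨⟨y, c⟩, d⟩ := p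
    have h : ((y.out + d.1 : A) : A ⧸ AddSubgroup.zmultiples j) = y := by
      rw [QuotientAddGroup.mk_add_of_mem _ d.2]
      exact Quotient.out_eq' y
    simp [h]

theorem card_eq_of_free (hfree : ∀ x (i : ℤ), (g ^ i) x = x ↔ i • j = 0) : Nat.card α =
    Nat.card (Quotient (Equiv.Perm.SameCycle.setoid g)) * Nat.card (AddSubgroup.zmultiples j) := by
  obtain ⟨a, ha, haj⟩ := exists_label g j fun x i => (hfree x i).1
  rw [← Nat.card_prod]
  refine Nat.card_congr (Equiv.ofBijective
    (fun x => (Quotient.mk (Equiv.Perm.SameCycle.setoid g) x, ⟨a x, haj x⟩))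
      ⟨fun x y hxy => ?_, ?_⟩)
  · obtain ⟨i, rfl⟩ : ∃ i : ℤ, (g ^ i) x = y := Quotient.exact (Prod.ext_iff.1 hxy).1
    have h1 : a x = a ((g ^ i) x) := congrArg Subtype.val (Prod.ext_iff.1 hxy).2
    rw [label_zpow ha, left_eq_add] at h1
    exact ((hfree x i).2 h1).symm
  · rintro ⟨⟨x⟩, ⟨b, hb⟩⟩
    obtain ⟨i, hi⟩ := AddSubgroup.mem_zmultiples_iff.1 (AddSubgroup.sub_mem _ hb (haj x))
    refine ⟨(g ^ i) x, Prod.ext (Quotient.sound ?_) (Subtype.ext ?_)⟩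
    · exact Equiv.Perm.sameCycle_zpow_left.2 (Equiv.Perm.SameCycle.refl g x)
    · change a ((g ^ i) x) = b
      rw [label_zpow ha, hi, add_sub_cancel]

/-- Subtracting a reference labelling turns colourings into functions on the orbits of `g`.
Injectivity means that distinct orbits hit distinct coset-colour pairs; the offset inside each coset
of `⟨j⟩` is free. -/
theorem card_injective_colouring [Finite α] [Finite A]
    (hfree : ∀ x (i : ℤ), (g ^ i) x = x ↔ i • j = 0) (q : ℕ) :
    Nat.card {f : Colouring g j q // Function.Injective f.1} =
      Nat.card (AddSubgroup.zmultiples j) ^ Nat.card (Quotient (Equiv.Perm.SameCycle.setoid g)) *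
        (Nat.card (A ⧸ AddSubgroup.zmultiples j) * q).descFactorial
          (Nat.card (Quotient (Equiv.Perm.SameCycle.setoid g))) := by
  obtain ⟨a, ha, haj⟩ := exists_label g j fun x i => (hfree x i).1
  let O := Quotient (Equiv.Perm.SameCycle.setoid g)
  let D := AddSubgroup.zmultiples j
  have hOg : ∀ x, (Quotient.mk _ (g x) : O) = Quotient.mk _ x := fun x =>
    Quotient.sound (Equiv.Perm.sameCycle_apply_left.2 (Equiv.Perm.SameCycle.refl g x))
  have := Fintype.ofFinite O
  have := Fintype.ofFinite ((A ⧸ D) × Fin q)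
  have h1 : Nat.card (O ↪ (A ⧸ D) × Fin q) = (Nat.card (A ⧸ D) * q).descFactorial (Nat.card O) := by
    classical
    rw [Nat.card_eq_fintype_card, Fintype.card_embedding_eq, ← Nat.card_eq_fintype_card,
      ← Nat.card_eq_fintype_card, Nat.card_prod, Nat.card_fin]
  have h2 : Nat.card (O → D) = Nat.card D ^ Nat.card O := Nat.card_fun
  rw [← h1, ← h2, ← Nat.card_prod]
  have hlift : ∀ f : Colouring g j q, ∀ x y, Equiv.Perm.SameCycle g x y →
      (((f.1 x).1 - a x, (f.1 x).2) : A × Fin q) = ((f.1 y).1 - a y, (f.1 y).2) := by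
    intro f x y hxy
    refine apply_eq_of_sameCycle (h := fun x => ((f.1 x).1 - a x, (f.1 x).2)) (fun z => ?_) hxy
    rw [f.2, ha]
    simp
  let e1 : Colouring g j q ≃ (O → A × Fin q) :=
    { toFun := fun f => Quotient.lift (fun x => ((f.1 x).1 - a x, (f.1 x).2)) (hlift f)
      invFun := fun φ => ⟨fun x => (a x + (φ (Quotient.mk _ x)).1, (φ (Quotient.mk _ x)).2),
        fun x => by
          change (a (g x) + (φ (Quotient.mk _ (g x))).1, (φ (Quotient.mk _ (g x))).2) = _
          rw [hOg, ha]
          exact Prod.ext (add_right_comm _ _ _) rfl⟩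
      left_inv := fun f => Subtype.ext (funext fun x => by simp)
      right_inv := fun φ => funext fun o => by
        induction o using Quotient.inductionOn
        simp }
  let P : (O → A × Fin q) → O → (A ⧸ D) × Fin q := fun φ o => ((φ o).1, (φ o).2)
  have he1 : ∀ f : Colouring g j q, Function.Injective f.1 ↔ Function.Injective (P (e1 f)) := by
    intro f
    refine ⟨fun hf o o' hoo' => ?_, fun hf x y hxy => ?_⟩
    · induction o using Quotient.inductionOn with | _ x
      induction o' using Quotient.inductionOn with | _ y
      have h3 : -((f.1 x).1 - a x) + ((f.1 y).1 - a y) ∈ D :=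
        QuotientAddGroup.eq.1 (Prod.ext_iff.1 hoo').1
      have h4 : (f.1 x).2 = (f.1 y).2 := (Prod.ext_iff.1 hoo').2
      have h5 : (f.1 y).1 - (f.1 x).1 ∈ D := by
        have := D.add_mem h3 (D.sub_mem (haj y) (haj x))
        convert this using 1
        abel
      obtain ⟨i, hi⟩ := AddSubgroup.mem_zmultiples_iff.1 h5
      have h6 : f.1 ((g ^ i) x) = f.1 y := by
        refine Prod.ext ?_ ?_
        · rw [label_zpow (a := fun x => (f.1 x).1) (fun x => congrArg Prod.fst (f.2 x)) i x, hi]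
          exact add_sub_cancel _ _
        · rw [← h4]
          exact (congrArg Prod.snd (hlift f x _ ⟨i, rfl⟩)).symm
      exact Quotient.sound ⟨i, hf h6⟩
    · have h3 : (Quotient.mk _ x : O) = Quotient.mk _ y := hf (Prod.ext (by
        refine QuotientAddGroup.eq.2 ?_
        change -((f.1 x).1 - a x) + ((f.1 y).1 - a y) ∈ D
        rw [hxy]
        have := D.sub_mem (haj x) (haj y)
        convert this using 1
        abel) (show (f.1 x).2 = (f.1 y).2 from congrArg Prod.snd hxy))
      obtain ⟨i, rfl⟩ : ∃ i : ℤ, (g ^ i) x = y := Quotient.exact h3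
      have h4 := congrArg Prod.fst hxy
      rw [label_zpow (a := fun x => (f.1 x).1) (fun x => congrArg Prod.fst (f.2 x)) i x,
        left_eq_add] at h4
      exact ((hfree x i).2 h4).symm
  let E := quotientProdEquiv j q
  let e2 : {φ : O → A × Fin q // Function.Injective (P φ)} ≃ (O → D) × (O ↪ (A ⧸ D) × Fin q) :=
    { toFun := fun φ => (fun o => (E (φ.1 o)).2, ⟨P φ.1, φ.2⟩)
      invFun := fun p => ⟨fun o => E.symm (p.2 o, p.1 o), by
        have : P (fun o => E.symm (p.2 o, p.1 o)) = p.2 := funext fun o =>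
          congrArg Prod.fst (E.apply_symm_apply (p.2 o, p.1 o))
        rw [this]
        exact p.2.injective⟩
      left_inv := fun φ => Subtype.ext (funext fun o => E.symm_apply_apply (φ.1 o))
      right_inv := fun p => Prod.ext
        (funext fun o => congrArg Prod.snd (E.apply_symm_apply (p.2 o, p.1 o)))
        (DFunLike.ext _ _ fun o => congrArg Prod.fst (E.apply_symm_apply (p.2 o, p.1 o))) }
  exact Nat.card_congr ((e1.subtypeEquiv he1).trans e2)

end Free

/-! ### Partitions whose blocks are permuted transitively. -/

section Transitive

variable {α : Type} {g : Equiv.Perm α} (r : InvariantSetoid g)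

/-- The permutation of the blocks of an invariant partition. -/
def blockPerm : Equiv.Perm (Quotient r.1) :=
  Quotient.congr g fun x y => (r.2 x y).symm

theorem blockPerm_mk (x : α) : blockPerm r (Quotient.mk r.1 x) = Quotient.mk r.1 (g x) := rfl

variable {r}

/-- Having blocks in the same cycle is an equivalence relation coarser than `orbitJoin`, which has a
single class. -/
theorem sameCycle_blockPerm [Finite α] (hr : Nat.card (Quotient (orbitJoin g r.1)) = 1)
    (b b' : Quotient r.1) : (blockPerm r).SameCycle b b' := by
  let s : Setoid α := (Equiv.Perm.SameCycle.setoid (blockPerm r)).comap (Quotient.mk r.1)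
  have hs : orbitJoin g r.1 ≤ s := by
    refine (orbitJoin_le_iff g).2 ⟨fun x y hxy => ?_, fun x => ?_⟩
    · have h : Quotient.mk r.1 x = Quotient.mk r.1 y := Quotient.sound hxy
      change (blockPerm r).SameCycle (Quotient.mk r.1 x) (Quotient.mk r.1 y)
      rw [h]
    · change (blockPerm r).SameCycle (Quotient.mk r.1 x) (Quotient.mk r.1 (g x))
      rw [← blockPerm_mk]
      exact Equiv.Perm.sameCycle_apply_right.2 (Equiv.Perm.SameCycle.refl _ _)
  induction b using Quotient.inductionOn with | _ x
  induction b' using Quotient.inductionOn with | _ y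
  have := (Nat.card_eq_one_iff_unique.1 hr).1
  exact hs (Quotient.exact (Subsingleton.elim (Quotient.mk (orbitJoin g r.1) x) (Quotient.mk _ y)))

/-- Blocks permuted transitively have equal size. -/
theorem card_quotient_dvd [Finite α] (hr : Nat.card (Quotient (orbitJoin g r.1)) = 1) :
    Nat.card (Quotient r.1) ∣ Nat.card α := by
  rcases isEmpty_or_nonempty α with h | ⟨⟨x⟩⟩
  · simp
  have := Fintype.ofFinite (Quotient r.1)
  rw [← Nat.card_congr (Equiv.sigmaFiberEquiv (Quotient.mk r.1)), Nat.card_sigma]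
  have hc : ∀ b, Nat.card {y // Quotient.mk r.1 y = b} =
      Nat.card {y // Quotient.mk r.1 y = Quotient.mk r.1 x} := by
    intro b
    refine apply_eq_of_sameCycle (g := blockPerm r)
      (h := fun b => Nat.card {y // Quotient.mk r.1 y = b}) (fun b => ?_)
      (sameCycle_blockPerm hr _ _)
    refine (Nat.card_congr (g.subtypeEquiv fun y => ?_)).symm
    rw [← blockPerm_mk, (blockPerm r).injective.eq_iff]
  rw [Finset.sum_congr rfl fun b _ => hc b, Finset.sum_const, Finset.card_univ,
    ← Nat.card_eq_fintype_card]
  exact dvd_mul_right _ _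

theorem card_quotient_dvd_of_zpow_apply_eq [Finite α]
    (hr : Nat.card (Quotient (orbitJoin g r.1)) = 1) {b : Quotient r.1} {i : ℤ}
    (h : (blockPerm r ^ i) b = b) : (Nat.card (Quotient r.1) : ℤ) ∣ i := by
  have := Fintype.ofFinite (MulAction.orbit (Subgroup.zpowers (blockPerm r)) b)
  have h1 := (MulAction.zpow_smul_eq_iff_minimalPeriod_dvd (a := blockPerm r) (b := b)).1 h
  rw [MulAction.minimalPeriod_eq_card, ← Nat.card_eq_fintype_card] at h1
  have h2 : MulAction.orbit (Subgroup.zpowers (blockPerm r)) b = Set.univ := by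
    rw [Set.eq_univ_iff_forall]
    intro b'
    obtain ⟨k, hk⟩ := sameCycle_blockPerm hr b b'
    exact ⟨⟨blockPerm r ^ k, k, rfl⟩, hk⟩
  rwa [h2, Nat.card_congr (Equiv.Set.univ _)] at h1

/-- If a partition with more than one block is permuted transitively, then it has a labelling with
a nontrivial translation. -/
theorem exists_label_ne_zero [Finite α] {n : ℕ} [NeZero n] (hn : Nat.card α = n)
    (hr : Nat.card (Quotient (orbitJoin g r.1)) = 1) (htop : r.1 ≠ ⊤) :
    ∃ j : ZMod n, j ≠ 0 ∧ Nonempty (LabelOn g j r.1) := by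
  obtain ⟨k, hk⟩ := card_quotient_dvd hr
  rw [hn] at hk
  have hL : 1 < Nat.card (Quotient r.1) := by
    by_contra! h
    rw [Finite.card_le_one_iff_subsingleton] at h
    exact htop (Setoid.eq_top_iff.2 fun x y =>
      Quotient.exact (Subsingleton.elim (Quotient.mk r.1 x) (Quotient.mk r.1 y)))
  have hn0 : 0 < n := NeZero.pos n
  have hk0 : 0 < k := Nat.pos_of_mul_pos_left (hk ▸ hn0)
  -- The step `k` is `n` divided by the number of blocks, so labels close up modulo `n` after one
  -- cycle of blocks; it is nonzero because there are at least two blocks.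
  obtain ⟨a, ha, -⟩ := exists_label (blockPerm r) (k : ZMod n) fun b i hi => by
    obtain ⟨l, rfl⟩ := card_quotient_dvd_of_zpow_apply_eq hr hi
    rw [mul_comm, mul_zsmul, zsmul_eq_mul, zsmul_eq_mul, Int.cast_natCast, ← Nat.cast_mul, ← hk,
      ZMod.natCast_self, mul_zero]
  refine ⟨k, fun h => ?_, ⟨⟨fun x => a (Quotient.mk r.1 x), fun x => ?_, fun x y hxy => ?_⟩⟩⟩
  · rw [ZMod.natCast_eq_zero_iff] at h
    have := Nat.le_of_dvd hk0 h
    nlinarith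
  · exact ha (Quotient.mk r.1 x)
  · exact congrArg a (Quotient.sound hxy)

theorem card_label_add {A : Type} [AddCommGroup A] {j₀ : A} (a₀ : LabelOn g j₀ r.1) (j : A) :
    Nat.card (LabelOn g (j + j₀) r.1) = Nat.card (LabelOn g j r.1) := by
  refine Nat.card_congr
    { toFun := fun a => ⟨fun x => a.1 x - a₀.1 x, fun x => ?_, fun x y hxy => ?_⟩
      invFun := fun a => ⟨fun x => a.1 x + a₀.1 x, fun x => ?_, fun x y hxy => ?_⟩
      left_inv := fun a => by simp
      right_inv := fun a => by simp }
  · change a.1 (g x) - a₀.1 (g x) = a.1 x - a₀.1 x + j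
    rw [a.2.1, a₀.2.1]
    abel
  · exact congrArg₂ (· - ·) (a.2.2 hxy) (a₀.2.2 hxy)
  · change a.1 (g x) + a₀.1 (g x) = a.1 x + a₀.1 x + (j + j₀)
    rw [a.2.1, a₀.2.1]
    abel
  · exact congrArg₂ (· + ·) (a.2.2 hxy) (a₀.2.2 hxy)

/-- Reindexing by the translation `j₀` of a labelling multiplies the sum by `ψ j₀ ≠ 1`. -/
theorem sum_addChar_mul_card_label_of_ne_top [Finite α] {n : ℕ} [NeZero n] (hn : Nat.card α = n)
    (ψ : AddChar (ZMod n) ℂ) (hψ : ∀ j, ψ j = 1 → j = 0)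
    (hr : Nat.card (Quotient (orbitJoin g r.1)) = 1) (htop : r.1 ≠ ⊤) :
    ∑ j : ZMod n, ψ j * Nat.card (LabelOn g j r.1) = 0 := by
  obtain ⟨j₀, hj₀, ⟨a₀⟩⟩ := exists_label_ne_zero hn hr htop
  have h1 : ∑ j : ZMod n, ψ j * Nat.card (LabelOn g j r.1) =
      ψ j₀ * ∑ j : ZMod n, ψ j * Nat.card (LabelOn g j r.1) := by
    rw [Finset.mul_sum]
    refine (Fintype.sum_equiv (Equiv.addRight j₀) _ _ fun j => ?_).symm
    rw [Equiv.coe_addRight, card_label_add a₀, AddChar.map_add_eq_mul]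
    ring
  by_contra h
  exact hj₀ (hψ _ (mul_right_cancel₀ h (by rw [← h1, one_mul])))

end Transitive

section Top

variable {α : Type} (g : Equiv.Perm α)

instance : OrderTop (InvariantSetoid g) where
  top := ⟨⊤, fun _ _ => Iff.rfl⟩
  le_top r := (le_top : r.1 ≤ ⊤)

theorem card_quotient_orbitJoin_top [Nonempty α] : Nat.card (Quotient (orbitJoin g ⊤)) = 1 := by
  have h : orbitJoin g ⊤ = ⊤ := top_le_iff.1 ((orbitJoin_le_iff g).1 le_rfl).1
  rw [h, Nat.card_eq_one_iff_unique]
  refine ⟨⟨?_⟩, ⟨Quotient.mk _ (Classical.arbitrary α)⟩⟩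
  rintro ⟨x⟩ ⟨y⟩
  exact Quotient.sound trivial

/-- Labellings are constant, which forces `j = 0` and leaves `n` constants. -/
theorem sum_addChar_mul_card_label_top [Nonempty α] {n : ℕ} [NeZero n] (ψ : AddChar (ZMod n) ℂ) :
    ∑ j : ZMod n, ψ j * Nat.card (LabelOn g j ⊤) = n := by
  have h0 : ∀ j : ZMod n, LabelOn g j ⊤ → j = 0 := fun j a => by
    have h1 := a.2.1 (Classical.arbitrary α)
    have h2 : a.1 (g (Classical.arbitrary α)) = a.1 (Classical.arbitrary α) :=
      a.2.2 (trivial : (⊤ : Setoid α) _ _)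
    rwa [h2, left_eq_add] at h1
  rw [Finset.sum_eq_single 0 (fun j _ hj => ?_) (by simp), AddChar.map_zero_eq_one, one_mul]
  · refine (congrArg Nat.cast (?_ : _ = Nat.card (ZMod n))).trans (by rw [Nat.card_zmod])
    refine Nat.card_congr
      { toFun := fun a => a.1 (Classical.arbitrary α)
        invFun := fun b => ⟨fun _ => b, fun _ => (add_zero b).symm, fun _ _ _ => rfl⟩
        left_inv := fun a => Subtype.ext (funext fun x => a.2.2 (trivial : (⊤ : Setoid α) _ _))
        right_inv := fun b => rfl }
  · have : IsEmpty (LabelOn g j ⊤) := ⟨fun a => hj (h0 j a)⟩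
    simp

end Top

/-! ### Conjugation to translations and the Möbius number. -/

theorem sign_eq_of_conj_translation {N : ℕ} {g x : Equiv.Perm (Fin (N + 1))} {j : Fin (N + 1)}
    (hx : ∀ y, x (g y) = x y + j) :
    (Equiv.Perm.sign g : ℤ) * (-1) ^ (N + 1) = (-1) ^ Nat.gcd (N + 1) j := by
  have hpow : ∀ (k : ℕ) (y : Fin (N + 1)),
      (finRotate (N + 1) ^ k) y = y + k • (1 : Fin (N + 1)) := by
    intro k y
    induction k with
    | zero => simp
    | succ k ih =>
      rw [pow_succ', Equiv.Perm.mul_apply, ih, finRotate_apply, succ_nsmul, add_assoc]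
  have hj : (j : ℕ) • (1 : Fin (N + 1)) = j :=
    (nsmul_one (A := ZMod (N + 1)) _).trans (ZMod.natCast_zmod_val (n := N + 1) j)
  have hconj : x * g * x⁻¹ = finRotate (N + 1) ^ (j : ℕ) := by
    ext y
    rw [hpow, Equiv.Perm.mul_apply, Equiv.Perm.mul_apply, hx, hj]
    simp
  have hsign : Equiv.Perm.sign g = (-1) ^ (N * (j : ℕ)) := by
    have h1 := congrArg Equiv.Perm.sign hconj
    rw [map_mul, map_mul, map_inv, mul_right_comm, mul_inv_cancel, one_mul, map_pow,
      sign_finRotate, ← pow_mul] at h1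
    exact h1
  -- It remains that `N * j + N + 1` is even exactly when `N + 1` and `j` both are.
  rw [hsign, Units.val_pow_eq_pow_val, Units.val_neg, Units.val_one, ← pow_add, neg_one_pow_congr]
  have h2 : Even (Nat.gcd (N + 1) j) ↔ Even (N + 1) ∧ Even (j : ℕ) := by
    simp only [even_iff_two_dvd, Nat.dvd_gcd_iff]
  rw [h2]
  grind

/-- The bijections to `ZMod n` that conjugate `g` to the translation by `j`. -/
abbrev TranslationConj {α : Type} (g : Equiv.Perm α) {n : ℕ} (j : ZMod n) : Type :=
  {x : α ≃ ZMod n // ∀ y, x (g y) = x y + j}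

theorem card_translationConj {α : Type} [Finite α] {n : ℕ} [NeZero n] (hn : Nat.card α = n)
    (g : Equiv.Perm α) (j : ZMod n) :
    Nat.card (TranslationConj g j) = Nat.card {f : Colouring g j 1 // Function.Injective f.1} := by
  refine Nat.card_congr (Equiv.ofBijective (fun x => ⟨⟨fun y => (x.1 y, 0), fun y => ?_⟩,
    fun y y' h => x.1.injective (Prod.ext_iff.1 h).1⟩) ⟨fun x x' h => ?_, fun f => ?_⟩)
  · exact Prod.ext (x.2 y) rfl
  · refine Subtype.ext (Equiv.ext fun y => ?_)
    exact (Prod.ext_iff.1 (congrFun (congrArg (fun f => f.1.1) h) y)).1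
  · have hinj : Function.Injective fun y => (f.1.1 y).1 := fun y y' h =>
      f.2 (Prod.ext h (Subsingleton.elim _ _))
    have hbij := (Nat.bijective_iff_injective_and_card _).2 ⟨hinj, by rw [hn, Nat.card_zmod]⟩
    refine ⟨⟨Equiv.ofBijective _ hbij, fun y => ?_⟩, ?_⟩
    · exact (Prod.ext_iff.1 (f.1.2 y)).1
    · refine Subtype.ext (Subtype.ext (funext fun y => Prod.ext rfl (Subsingleton.elim _ _)))

open Classical in
-- Compare coefficients of `q`. If an injective colouring exists for some `q`, the linear
-- coefficient of `d^m * (m*q).descFactorial m` is `(-1)^(m+1)` times its value at `q = 1`, which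
-- counts the bijections; otherwise both sides vanish.
theorem sum_mobius_mul_card_label_of_transitive {N : ℕ} (g : Equiv.Perm (Fin (N + 1)))
    [Fintype (InvariantSetoid g)] (j : ZMod (N + 1)) :
    ∑ r : InvariantSetoid g with Nat.card (Quotient (orbitJoin g r.1)) = 1,
      mobius r * (Nat.card (LabelOn g j r.1) : ℤ) =
      (-1) ^ N * Equiv.Perm.sign g * Nat.card (TranslationConj g j) := by
  rw [card_translationConj (Nat.card_fin _)]
  by_cases h : ∃ q, Nonempty {f : Colouring g j q // Function.Injective f.1}
  · obtain ⟨q₀, ⟨f⟩⟩ := h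
    have hfree := zpow_apply_eq_self_iff_of_colouring f.1 f.2
    set m := Nat.card (Quotient (Equiv.Perm.SameCycle.setoid g)) with hm
    set d := Nat.card (AddSubgroup.zmultiples j) with hd
    have hd0 : 0 < d := Nat.card_pos
    have hm0 : 0 < m := by
      have : Nonempty (Quotient (Equiv.Perm.SameCycle.setoid g)) := ⟨Quotient.mk _ 0⟩
      exact Nat.card_pos
    have hmd : N + 1 = m * d := by
      rw [← card_eq_of_free hfree, Nat.card_fin]
    have hA : Nat.card (ZMod (N + 1) ⧸ AddSubgroup.zmultiples j) = m := by
      have h1 := AddSubgroup.card_eq_card_quotient_mul_card_addSubgroup (AddSubgroup.zmultiples j)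
      exact Nat.eq_of_mul_eq_mul_right hd0 ((h1.symm.trans (Nat.card_zmod _)).trans hmd)
    have hcount : ∀ q, Nat.card {f : Colouring g j q // Function.Injective f.1} =
        d ^ m * (m * q).descFactorial m := fun q => by
      rw [card_injective_colouring hfree, hA]
    rw [sum_filter_eq_one_of_sum_pow_eq_descFactorial _ _ (d ^ m) m hm0.ne' fun q => by
      rw [sum_mobius_mul_card_label, hcount, Nat.cast_mul], hcount, mul_one,
      Nat.descFactorial_self]
    have hne : 0 < Nat.card (TranslationConj g j) := by
      rw [card_translationConj (Nat.card_fin _), hcount, mul_one, Nat.descFactorial_self]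
      positivity
    obtain ⟨⟨x, hx⟩⟩ := (Nat.card_pos_iff.1 hne).1
    have hsign := sign_eq_of_conj_translation (x := x) (j := j) hx
    have hgcd : Nat.gcd (N + 1) (ZMod.val j) = m := by
      have h1 : d = (N + 1) / Nat.gcd (N + 1) (ZMod.val j) := by
        rw [hd, Nat.card_zmultiples, ← ZMod.addOrderOf_coe _ (Nat.succ_ne_zero N),
          ZMod.natCast_zmod_val]
      have h2 := Nat.div_mul_cancel (Nat.gcd_dvd_left (N + 1) (ZMod.val j))
      rw [← h1, mul_comm] at h2
      exact Nat.eq_of_mul_eq_mul_right hd0 (h2.trans hmd)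
    have hsign' : (Equiv.Perm.sign g : ℤ) * (-1) ^ (N + 1) = (-1) ^ m := by
      rw [← hgcd]
      exact hsign
    rw [pow_succ, ← hsign']
    push_cast
    ring
  · push Not at h
    -- The constant `K = 0` encodes the zero polynomial; `m = 1` is then arbitrary.
    have h0 := sum_filter_eq_one_of_sum_pow_eq_descFactorial
      (fun r : InvariantSetoid g => mobius r * (Nat.card (LabelOn g j r.1) : ℤ))
      (fun r => Nat.card (Quotient (orbitJoin g r.1))) 0 1 one_ne_zero fun q => by
        have := h q
        rw [sum_mobius_mul_card_label, Nat.card_of_isEmpty]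
        simp
    have := h 1
    rw [h0, Nat.card_of_isEmpty]
    simp

theorem card_mul_mobius_top {N : ℕ} (g : Equiv.Perm (Fin (N + 1))) (ψ : AddChar (ZMod (N + 1)) ℂ)
    (hψ : ∀ j, ψ j = 1 → j = 0) :
    (N + 1 : ℂ) * (mobius (⊤ : InvariantSetoid g) : ℂ) =
      (-1) ^ N * (Equiv.Perm.sign g : ℤ) *
        ∑ j : ZMod (N + 1), ψ j * Nat.card (TranslationConj g j) := by
  classical
  have := Fintype.ofFinite (InvariantSetoid g)
  have h1 : ∀ j : ZMod (N + 1), (-1 : ℂ) ^ N * (Equiv.Perm.sign g : ℤ) *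
      (ψ j * Nat.card (TranslationConj g j)) =
      ∑ r : InvariantSetoid g with Nat.card (Quotient (orbitJoin g r.1)) = 1,
        (mobius r : ℂ) * (ψ j * Nat.card (LabelOn g j r.1)) := fun j => by
    have h2 := congrArg (fun z : ℤ => ψ j * (z : ℂ)) (sum_mobius_mul_card_label_of_transitive g j)
    push_cast at h2
    rw [Finset.mul_sum] at h2
    rw [Finset.sum_congr rfl fun r _ => mul_left_comm _ _ _, h2]
    ring
  rw [Finset.mul_sum, Finset.sum_congr rfl fun j _ => h1 j, Finset.sum_comm]
  simp only [← Finset.mul_sum]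
  rw [Finset.sum_eq_single ⊤ (fun r hr hr' => ?_) fun h => ?_]
  · have h2 := sum_addChar_mul_card_label_top g ψ
    rw [show (⊤ : InvariantSetoid g).1 = ⊤ from rfl, h2]
    push_cast
    ring
  · rw [sum_addChar_mul_card_label_of_ne_top (Nat.card_fin _) ψ hψ (Finset.mem_filter.1 hr).2
      fun h => hr' (Subtype.ext h), mul_zero]
  · exact absurd
      (Finset.mem_filter.2 ⟨Finset.mem_univ (⊤ : InvariantSetoid g), card_quotient_orbitJoin_top g⟩)
        h

/-! ### The character of the induced representation. -/

theorem finRotate_zpow_apply {N : ℕ} (k : ℤ) (y : Fin (N + 1)) :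
    (finRotate (N + 1) ^ k) y = y + k • (1 : Fin (N + 1)) :=
  label_zpow (g := finRotate (N + 1)) (a := id) (j := 1) (fun x => finRotate_apply x) k y

theorem val_zsmul_one {N : ℕ} (j : Fin (N + 1)) : ((j : ℕ) : ℤ) • (1 : Fin (N + 1)) = j := by
  rw [natCast_zsmul]
  exact (nsmul_one (A := ZMod (N + 1)) _).trans (ZMod.natCast_zmod_val (n := N + 1) j)

/-- The cyclic subgroup is parametrized by the residues modulo its order. -/
noncomputable def cyclicEquiv (N : ℕ) : ZMod (N + 1) ≃ cyclicSubgroup (N + 1) :=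
  Equiv.ofBijective (fun j => cyclicGenerator (N + 1) ^ (ZMod.val j : ℤ)) (by
    have h : ∀ k : ℤ, ((cyclicGenerator (N + 1) ^ k : cyclicSubgroup (N + 1)) :
        Equiv.Perm (Fin (N + 1))) = finRotate (N + 1) ^ k := fun k => rfl
    refine ⟨fun j j' hj => ?_, fun x => ?_⟩
    · have h1 := congrArg (fun x : cyclicSubgroup (N + 1) => x.1 0) hj
      simp only [h, finRotate_zpow_apply, zero_add] at h1
      exact ((val_zsmul_one (N := N) j).symm.trans h1).trans (val_zsmul_one (N := N) j')
    · obtain ⟨k, rfl⟩ := mem_zpowers_cyclicGenerator (N + 1) x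
      refine ⟨(k • (1 : Fin (N + 1)) : Fin (N + 1)), Subtype.ext (Equiv.ext fun y => ?_)⟩
      change (finRotate (N + 1) ^ _) y = (finRotate (N + 1) ^ k) y
      rw [finRotate_zpow_apply, finRotate_zpow_apply]
      congr 1
      exact val_zsmul_one (N := N) _)

theorem cyclicCharacter_cyclicEquiv {N : ℕ} (j : ZMod (N + 1)) :
    (cyclicCharacter (N + 1) (cyclicEquiv N j) : ℂ) = ZMod.stdAddChar j := by
  change (cyclicCharacter (N + 1) (cyclicGenerator (N + 1) ^ (ZMod.val j : ℤ)) : ℂ) = _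
  have h1 : (ZMod.stdAddChar (1 : ZMod (N + 1)) : ℂ) =
      Complex.exp (2 * Real.pi * Complex.I / (N + 1 : ℕ)) := by
    have := ZMod.stdAddChar_coe (N := N + 1) 1
    simpa using this
  rw [zpow_natCast, map_pow, Units.val_pow_eq_pow_val, cyclicCharacter_cyclicGenerator, ← h1,
    ← AddChar.map_nsmul_eq_pow, nsmul_one, ZMod.natCast_zmod_val]

theorem character_lieRep {N : ℕ} (g : Equiv.Perm (Fin (N + 1))) :
    (lieRep (N + 1)).character g = (N + 1 : ℂ)⁻¹ *
      ∑ j : ZMod (N + 1), (ZMod.stdAddChar j : ℂ) * Nat.card (TranslationConj g j) := by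
  have := Fintype.ofFinite (cyclicSubgroup (N + 1))
  have hcard : Fintype.card (cyclicSubgroup (N + 1)) = N + 1 := by
    rw [← Fintype.card_congr (cyclicEquiv N), ZMod.card]
  rw [lieRep, character_ind_linearCharacterRep, hcard, Nat.cast_succ]
  congr 1
  refine (Fintype.sum_equiv (cyclicEquiv N) _ _ fun j => ?_).symm
  rw [cyclicCharacter_cyclicEquiv, mul_comm]
  congr 2
  have h : ((ZMod.val j : ℕ) : ℤ) • (1 : Fin (N + 1)) = j := val_zsmul_one (N := N) j
  refine Nat.card_congr (Equiv.subtypeEquivRight (α := Equiv.Perm (Fin (N + 1))) fun x => ?_).symm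
  change x * g * x⁻¹ = finRotate (N + 1) ^ (ZMod.val j : ℤ) ↔ _
  rw [mul_inv_eq_iff_eq_mul, Equiv.ext_iff]
  refine forall_congr' fun y => ?_
  rw [Equiv.Perm.mul_apply, Equiv.Perm.mul_apply, finRotate_zpow_apply, h]
  rfl

theorem character_lieRep_tprod_signRep {N : ℕ} (g : Equiv.Perm (Fin (N + 1))) :
    ((lieRep (N + 1)).tprod (signRep (N + 1))).character g =
      (-1) ^ N * (mobius (⊤ : InvariantSetoid g) : ℂ) := by
  have : Module.Finite ℂ (MonoidAlgebra ℂ (Equiv.Perm (Fin (N + 1)))) :=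
    Module.Finite.equiv (MonoidAlgebra.coeffLinearEquiv ℂ).symm
  have hs : (signRep (N + 1)).character g = ((Equiv.Perm.sign g : ℤ) : ℂ) :=
    trace_linearCharacterRep _ _
  have hs2 : ((Equiv.Perm.sign g : ℤ) : ℂ) * ((Equiv.Perm.sign g : ℤ) : ℂ) = 1 := by
    rw [← Int.cast_mul, ← Units.val_mul, Int.units_mul_self]
    simp
  have h1 := card_mul_mobius_top g (ZMod.stdAddChar (N := N + 1)) fun j hj =>
    ZMod.injective_stdAddChar (hj.trans (AddChar.map_zero_eq_one _).symm)
  have hN : (N + 1 : ℂ) ≠ 0 := Nat.cast_add_one_ne_zero N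
  have h2 : (mobius (⊤ : InvariantSetoid g) : ℂ) = (-1) ^ N * (Equiv.Perm.sign g : ℤ) *
      (lieRep (N + 1)).character g := by
    rw [character_lieRep, mul_left_comm, ← h1, inv_mul_cancel_left₀ hN]
  have h3 : (-1 : ℂ) ^ N * (-1) ^ N = 1 := by
    rw [← mul_pow]
    simp
  rw [Representation.char_tensor, Pi.mul_apply, hs, h2, ← mul_assoc, ← mul_assoc, h3, one_mul,
    mul_comm]

/-! ### Comparison of the two characters. -/

theorem fixed_iff_invariant {n : ℕ} (g : Equiv.Perm (Fin n)) (r : Setoid (Fin n)) :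
    partitionAction n g r = r ↔ ∀ x y, r (g x) (g y) ↔ r x y := by
  refine ⟨fun h x y => ?_, fun h => Setoid.ext fun x y => ?_⟩
  · have h1 : partitionAction n g r (g x) (g y) ↔ r (g⁻¹ (g x)) (g⁻¹ (g y)) := Iff.rfl
    rw [h] at h1
    simpa using h1
  · have h1 := h (g⁻¹ x) (g⁻¹ y)
    simp only [Equiv.Perm.inv_def, Equiv.apply_symm_apply] at h1
    exact h1.symm

theorem card_fixed_chains {n : ℕ} (g : Equiv.Perm (Fin n)) (k : ℕ) :
    Nat.card {c : Fin k ↪o ProperPart (PartitionLattice n) //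
      c.trans (properPartAction (partitionAction n) g).toOrderEmbedding = c} =
      chainCount k (⊤ : InvariantSetoid g) := by
  have hfix : ∀ c : Fin k ↪o ProperPart (PartitionLattice n),
      c.trans (properPartAction (partitionAction n) g).toOrderEmbedding = c ↔
        ∀ i x y, (c i).1 (g x) (g y) ↔ (c i).1 x y := by
    intro c
    simp only [← fixed_iff_invariant]
    refine ⟨fun h i => congrArg Subtype.val (DFunLike.congr_fun h i), fun h => ?_⟩
    exact DFunLike.ext _ _ fun i => Subtype.ext (h i)
  have hbot : ∀ r : InvariantSetoid g, r = ⊥ ↔ r.1 = ⊥ := fun r => Subtype.ext_iff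
  have htop : ∀ r : InvariantSetoid g, r = ⊤ ↔ r.1 = ⊤ := fun r => Subtype.ext_iff
  exact Nat.card_congr
    { toFun := fun c => ⟨OrderEmbedding.ofMapLEIff
          (fun i => (⟨(c.1 i).1, (hfix c.1).1 c.2 i⟩ : InvariantSetoid g))
          fun i j => c.1.le_iff_le,
        fun i => ⟨bot_lt_iff_ne_bot.2 ((hbot _).not.2 (c.1 i).2.1),
          lt_top_iff_ne_top.2 ((htop _).not.2 (c.1 i).2.2)⟩⟩
      invFun := fun c => ⟨OrderEmbedding.ofMapLEIff
          (fun i => (⟨(c.1 i).1, (hbot _).not.1 (c.2 i).1.ne', (htop _).not.1 (c.2 i).2.ne⟩ :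
            ProperPart (PartitionLattice n)))
          fun i j => c.1.le_iff_le,
        (hfix _).2 fun i => (c.1 i).2⟩
      left_inv := fun c => rfl
      right_inv := fun c => rfl }

theorem character_properPart {n : ℕ} (hn : 2 ≤ n) (g : Equiv.Perm (Fin n)) :
    (orderHomology (properPartAction (partitionAction n)) (n - 2)).ρ.character g =
      (-1) ^ (n - 1) * (mobius (⊤ : InvariantSetoid g) : ℂ) := by
  have hbot : (⊤ : InvariantSetoid g) ≠ ⊥ := by
    intro h
    have h1 : (⊥ : Setoid (Fin n)) ⟨0, by omega⟩ ⟨1, by omega⟩ := by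
      have h2 : (⊤ : Setoid (Fin n)) = ⊥ := congrArg Subtype.val h
      rw [← h2]
      trivial
    exact absurd (congrArg Fin.val h1) (by simp)
  rw [character_orderHomology _ _ (fun k hk => orderCycles_properPart_le hk)
    isEmpty_properPart_chain, mobius_eq_sum hbot (N := n - 2 + 1) fun k hk => ?_]
  · push_cast
    rw [Finset.mul_sum]
    refine Finset.sum_congr rfl fun k _ => ?_
    rw [card_fixed_chains, ← mul_assoc, ← pow_add, show n - 1 + (k + 1) = (n - 2 + k) + 2 by omega,
      pow_add _ _ 2]
    simp
  · rw [← card_fixed_chains, Nat.card_eq_zero]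
    exact Or.inl ⟨fun c => absurd (length_le_of_properPart_chain c.1) (by omega)⟩

theorem finiteDimensional_subquotientRep {G V : Type} [Group G] [AddCommGroup V] [Module ℂ V]
    [FiniteDimensional ℂ V] {ρ : Representation ℂ G V} {Z B : Submodule ℂ V}
    (hZ : ∀ g, Z ≤ Z.comap (ρ g)) (hB : ∀ g, B ≤ B.comap (ρ g)) :
    FiniteDimensional ℂ (Rep.of (subquotientRep ρ Z B hZ hB)) :=
  inferInstanceAs (FiniteDimensional ℂ (Z ⧸ B.submoduleOf Z))

instance {n k : ℕ} :
    FiniteDimensional ℂ (orderHomology (properPartAction (partitionAction n)) k) :=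
  finiteDimensional_subquotientRep (orderCycles_invariant _ k) (orderBoundaries_invariant _ k)

theorem Rep.nonempty_iso_of_character_eq {G : Type} [Group G] [Finite G] (A B : Rep.{0} ℂ G)
    [FiniteDimensional ℂ A] [FiniteDimensional ℂ B] (h : A.ρ.character = B.ρ.character) :
    Nonempty (A ≅ B) :=
  (Representation.nonempty_equiv_of_character_eq h).map Rep.mkIso

theorem theorem3 (n : ℕ) (hn : 1 ≤ n) :
    Nonempty (properPartHomology (partitionAction n) ((n : ℤ) - 3) ≅
      Rep.of ((lieRep n).tprod (signRep n))) := by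
  obtain ⟨N, rfl⟩ := Nat.exists_eq_succ_of_ne_zero (Nat.one_le_iff_ne_zero.1 hn)
  have : Module.Finite ℂ (MonoidAlgebra ℂ (Equiv.Perm (Fin (N + 1)))) :=
    Module.Finite.equiv (MonoidAlgebra.coeffLinearEquiv ℂ).symm
  rcases Nat.eq_zero_or_pos N with rfl | hN
  -- For `n = 1` the homology is trivial by convention, matching `mobius ⊥ = 1`.
  · have hbt : (⊥ : PartitionLattice 1) = ⊤ :=
      Setoid.ext fun x y => ⟨fun _ => trivial, fun _ => Subsingleton.elim x y⟩
    rw [properPartHomology, if_pos hbt, if_pos (by norm_num)]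
    refine Rep.nonempty_iso_of_character_eq _ _ (funext fun g => ?_)
    have htop : (⊤ : InvariantSetoid g) = ⊥ := Subtype.ext hbt.symm
    rw [character_lieRep_tprod_signRep, htop, mobius_bot]
    have h1 : (Rep.trivial ℂ (Equiv.Perm (Fin 1)) ℂ).ρ g = 1 := rfl
    simp [Representation.character, h1]
  · have hbt : (⊥ : PartitionLattice (N + 1)) ≠ ⊤ := by
      intro h
      have h1 : (⊥ : Setoid (Fin (N + 1))) 0 (Fin.last N) := by
        rw [h]
        trivial
      exact absurd (congrArg Fin.val h1) (by simpa using hN.ne)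
    -- Homology in degree `n - 3` is carried by chains with `n - 2` elements.
    rw [properPartHomology, if_neg hbt, if_pos (by push_cast; omega),
      show (((N + 1 : ℕ) : ℤ) - 3 + 1).toNat = N + 1 - 2 by omega]
    refine Rep.nonempty_iso_of_character_eq _ _ (funext fun g => ?_)
    rw [character_properPart (by omega), character_lieRep_tprod_signRep]
    rfl
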